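/- Let $n\ge 2$. There exist a function $\bar\rho\in C_c^\infty(\mathbb R^n)$ with $\bar\rho\ge 0$ and $\int\bar\rho\,dx=1$ and a continuous, compactly supported vector field $\bar v:\mathbb R^n\to\mathbb R^n$ such that for no $T>0$ and no open set $D\subset\mathbb R^n$ of Lebesgue measure $1$ does there exist a sticky weak solution $X:[0,T]\times D\to\mathbb R^n$ of the pressureless gas system $$\partial_t\rho+\operatorname{div}(\rho v)=0,\qquad \partial_t(\rho v)+\operatorname{div}(\rho v\otimes v)=0,\qquad \rho(0,\cdot)=\bar\rho,\quad v(0,\cdot)=\bar v .$$ Here a flow map is a map $X:[0,T]\times D\to\mathbb R^n$, measurable in $y$, such that for almost every $y\in D$ the path $t\mapsto X(t,y)$ is continuous on $[0,T]$ and has a forward derivative $X_t(t,y)$ at every $t\in[0,T)$, and such that $\sup_{t\in[0,T)}\int_D|X_t(t,y)|^2\,dy<\infty$. Let $J(X)$ be the completion of $C_c^1([0,T]\times\mathbb R^n)$ for the norm $\|\theta\|_J=\big(\int_0^T\!\int_D|\theta(t,X(t,y))|^2\,dy\,dt\big)^{1/2}$ and, for $t\in[0,T]$, let $J(X,t)$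 be the completion of $C_c^1(\mathbb R^n)$ for the norm $\|\phi\|_{J,t}=\big(\int_D|\phi(X(t,y))|^2\,dy\big)^{1/2}$; let $K(X,t)=\{\phi\circ X(t,\cdot):\phi\in J(X,t)\}\subset L^2(D)$ (with scalar-valued or $\mathbb R^n$-valued functions, as the context requires). Elements of these completions are represented by Borel functions of $(t,x)$, respectively of $x$. For $g\in L^2(D;\mathbb R^n)$, $W(X)g$ denotes the element $v\in J(X)$ such that for every $t\in[0,T]$ one has $v(t,\cdot)\in J(X,t)$, $\|v(t,\cdot)\|_{J,t}\le\|g\|_{L^2(D)}$ and $v(t,X(t,\cdot))-g\perp K(X,t)$. A flow map $X$ is a sticky weak solution on $[0,T]$ with initial data $(\bar\rho,\bar v)$ if: 1. (weak solution) $X_t=(W(X)\,X_t(0,\cdot))\circ X$ in $L^2([0,T]\times D)$; 2. (initial data) for every scalar $\phi\in J(X,0)$, $\int_D\phi(X(0,y))\,dy=\int\phi\,\bar\rho\,dx$ and $\int_D X_t(0,y)\,\phi(X(0,y))\,dy=\int\bar v\,\phi\,\bar\rho\,dx$; 3. (sticky property) for all $y_1,y_2\in D$ and $t_0\in[0,T]$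 with $X(t_0,y_1)=X(t_0,y_2)$, one has $X(t,y_1)=X(t,y_2)$ for all $t\in[t_0,T]$. -/

import Mathlib

open MeasureTheory Set
open scoped ContDiff ENNReal RealInnerProductSpace

noncomputable section

namespace StickyGas

/-- The space `ℝⁿ` with its Euclidean norm and Lebesgue measure. -/
abbrev Space (n : ℕ) : Type := EuclideanSpace ℝ (Fin n)

/-- Lebesgue measure on the set `D` of Lagrangian labels. -/
abbrev labels {n : ℕ} (D : Set (Space n)) : Measure (Space n) :=
  (volume : Measure (Space n)).restrict D

/-- Lebesgue measure on `[0,T] × D`. -/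
abbrev timeLabels {n : ℕ} (T : ℝ) (D : Set (Space n)) : Measure (ℝ × Space n) :=
  ((volume : Measure ℝ).restrict (Icc 0 T)).prod (labels D)

/-- The forward (right) time derivative `X_t(t,y)` of a map `X : (t,y) ↦ X(t,y)`. -/
def forwardDeriv {n : ℕ} (X : ℝ → Space n → Space n) (t : ℝ) (y : Space n) : Space n :=
  derivWithin (fun s => X s y) (Ici t) t

/-- `X : [0,T] × D → ℝⁿ` (only its values there matter) is a flow map: every `X(t,·)` is measurable,
almost every trajectory is continuous on `[0,T]` and has a forward derivative at each time
`t ∈ [0,T)`, and `sup_t ∫_D |X_t(t,y)|² dy < ∞`. -/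
structure IsFlow {n : ℕ} (T : ℝ) (D : Set (Space n)) (X : ℝ → Space n → Space n) : Prop where
  measurable : ∀ t ∈ Icc 0 T, AEMeasurable (X t) (labels D)
  continuous : ∀ᵐ y ∂(labels D), ContinuousOn (fun t => X t y) (Icc 0 T)
  differentiable : ∀ᵐ y ∂(labels D), ∀ t ∈ Ico 0 T,
    DifferentiableWithinAt ℝ (fun s => X s y) (Ici t) t
  energy : ∃ C : ℝ≥0∞, C < ⊤ ∧
    ∀ t ∈ Ico 0 T, ∫⁻ y, ‖forwardDeriv X t y‖ₑ ^ 2 ∂(labels D) ≤ C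

/-- The space `J(X)`, the completion of `C¹_c([0,T] × ℝⁿ)` for the norm
`‖θ‖_J = (∫₀ᵀ ∫_D |θ(t, X(t,y))|² dy dt)^{1/2}`. Its elements are represented by the Borel functions
`θ` on `[0,T] × ℝⁿ` which are limits, in this norm, of functions in `C¹_c`. -/
def spaceJ {n : ℕ} (F : Type*) [NormedAddCommGroup F] [NormedSpace ℝ F] [MeasurableSpace F]
    (T : ℝ) (D : Set (Space n)) (X : ℝ → Space n → Space n) : Set (ℝ → Space n → F) :=
  {θ | Measurable (Function.uncurry θ) ∧
    ∀ ε : ℝ≥0∞, 0 < ε → ∃ η : ℝ × Space n → F, ContDiff ℝ 1 η ∧ HasCompactSupport η ∧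
      eLpNorm (fun p : ℝ × Space n => θ p.1 (X p.1 p.2) - η (p.1, X p.1 p.2)) 2
        (timeLabels T D) < ε}

/-- The section `J(X,t)`, the completion of `C¹_c(ℝⁿ)` for the norm
`‖φ‖_{J,t} = (∫_D |φ(X(t,y))|² dy)^{1/2}`; elements are represented by Borel functions as above. -/
def sectionJ {n : ℕ} (F : Type*) [NormedAddCommGroup F] [NormedSpace ℝ F] [MeasurableSpace F]
    (D : Set (Space n)) (X : ℝ → Space n → Space n) (t : ℝ) : Set (Space n → F) :=
  {φ | Measurable φ ∧
    ∀ ε : ℝ≥0∞, 0 < ε → ∃ η : Space n → F, ContDiff ℝ 1 η ∧ HasCompactSupport η ∧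
      eLpNorm (fun y => φ (X t y) - η (X t y)) 2 (labels D) < ε}

/-- `K(X,t) = {φ ∘ X(t,·) ; φ ∈ J(X,t)} ⊂ L²(D)`. -/
def sectionK {n : ℕ} (F : Type*) [NormedAddCommGroup F] [NormedSpace ℝ F] [MeasurableSpace F]
    (D : Set (Space n)) (X : ℝ → Space n → Space n) (t : ℝ) : Set (Space n → F) :=
  (fun φ : Space n → F => φ ∘ X t) '' sectionJ F D X t

/-- `v = W(X) g`: the element `v` of `J(X)` such that for every `t ∈ [0,T]`,
`v(t,·) ∈ J(X,t)`, `‖v(t,·)‖_{J,t} ≤ ‖g‖_{L²(D)}` and `v ∘ X(t,·) - g ⟂ K(X,t)`. -/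
structure IsW {n : ℕ} (T : ℝ) (D : Set (Space n)) (X : ℝ → Space n → Space n)
    (g : Space n → Space n) (v : ℝ → Space n → Space n) : Prop where
  mem : v ∈ spaceJ (Space n) T D X
  mem_section : ∀ t ∈ Icc 0 T, v t ∈ sectionJ (Space n) D X t
  norm_le : ∀ t ∈ Icc 0 T,
    eLpNorm (fun y => v t (X t y)) 2 (labels D) ≤ eLpNorm g 2 (labels D)
  orthogonal : ∀ t ∈ Icc 0 T, ∀ k ∈ sectionK (Space n) D X t,
    ∫ y, ⟪v t (X t y) - g y, k y⟫ ∂(labels D) = 0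

/-- `X : [0,T] × D → ℝⁿ` is a sticky weak solution of the pressureless gas system with initial mass
distribution `ρ` and initial velocity `v₀`. -/
structure IsStickyWeakSolution {n : ℕ} (ρ : Measure (Space n)) (v₀ : Space n → Space n)
    (T : ℝ) (D : Set (Space n)) (X : ℝ → Space n → Space n) : Prop where
  flow : IsFlow T D X
  /-- `X_t = (W(X) X_t(0,·)) ∘ X` in `L²([0,T] × D)`. -/
  weak : ∃ v : ℝ → Space n → Space n, IsW T D X (forwardDeriv X 0) v ∧
    ∀ᵐ p ∂(timeLabels T D), forwardDeriv X p.1 p.2 = v p.1 (X p.1 p.2)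
  initial_density : ∀ φ ∈ sectionJ ℝ D X 0,
    ∫ y, φ (X 0 y) ∂(labels D) = ∫ x, φ x ∂ρ
  initial_momentum : ∀ φ ∈ sectionJ ℝ D X 0,
    ∫ y, φ (X 0 y) • forwardDeriv X 0 y ∂(labels D) = ∫ x, φ x • v₀ x ∂ρ
  sticky : ∀ y₁ ∈ D, ∀ y₂ ∈ D, ∀ t₀ ∈ Icc 0 T, X t₀ y₁ = X t₀ y₂ →
    ∀ t ∈ Icc t₀ T, X t y₁ = X t y₂

end StickyGas

end

noncomputable section

namespace StickyGas

open Filter Topology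

/-! ### Scales -/

/-! The obstruction is Yablo's paradox, realised by particles whose collisions accumulate at time
`0`. Level `k` has a time scale `scale k`, tending to `0` very fast, and two particles in a plane.
`inl k` starts at `(reach k, 0)` and runs left along the axis with speed `speed k`, so that
undisturbed it passes the origin at time `scale k`. `inr k` falls from above towards the target `(y
k, 0)`, which it reaches at time `2 * scale k`; here `y k` is where a cluster consisting of all `inl
j`, `k ≤ j`, would be at that time. Let `E k` say that `inl k` and `inr k` coincide at time `2 *
scale k`.

If no `E j` with `j > k` holds, every such `inr j` slips through the axis and remains alone
(`alone_of_no_collision`). The particle `inl k`, faster and much heavier than the later ones, then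
sweeps up all of them, and the cluster sits exactly at `y k`: `E k` holds (`collision`). Conversely,
if `E k` holds, the center of mass identity forces the cluster at `y k` to contain every `inl j` and
no `inr j` with `j > k`; had `E j` occurred, stickiness would have kept `inr j` in that cluster
(`ne_of_collision`). So, once `2 * scale k ≤ T`, `E k` holds exactly when `E j` fails for all `j >
k`, which no sequence of truth values satisfies (`false_of_pos`). Higher levels act earlier, so
every positive `T` leaves infinitely many levels in play.

The discrete dynamics enters only through `IsStickySystem`: unit Lipschitz paths, stickiness,
isolation of each particle up to `isoTime`, and the fact that a cluster sits at the weighted mean of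
the free positions of its members. Rapid decay of masses and speeds makes one term dominate each
such mean.

To reach smooth densities and continuous velocities, each particle is replaced by a small ball of
gas whose velocity field contracts it to a point at time `isoTime`; rapidly decreasing masses make
the density smooth. For a sticky weak solution, the velocity at time `t` is the conditional
expectation of the initial velocity given `X(t, ·)`. Since stickiness makes `X(t, ·)` a function of
`X(s, ·)` for `s ≤ t`, integration in time shows that the position is the conditional expectation of
the free motion (`isStickyTransport`). Hence the balls do focus (`ae_eq_of_isoTime`), then move as
particles by stickiness, and their centers of mass form a sticky system (`exists_isStickySystem`).
-/

/-- The speed of the gas chunks at level `k`. -/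
def speed (k : ℕ) : ℝ := (1 / 100) ^ (k + 1)

/-- The time scale of level `k`. -/
def scale : ℕ → ℝ
  | 0 => 1
  | k + 1 => speed k * scale k / 10000

/-- The length scale of level `k`. -/
def reach (k : ℕ) : ℝ := speed k * scale k

/-- The time up to which chunks of level `k` are isolated. -/
def isoTime (k : ℕ) : ℝ := reach k / 100

lemma speed_pos (k : ℕ) : 0 < speed k := by unfold speed; positivity

lemma speed_succ (k : ℕ) : speed (k + 1) = speed k / 100 := by
  unfold speed; rw [pow_succ _ (k + 1)]; ring

lemma speed_le (k : ℕ) : speed k ≤ 1 / 100 := by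
  induction k with
  | zero => norm_num [speed]
  | succ k ih => rw [speed_succ]; linarith

lemma scale_pos (k : ℕ) : 0 < scale k := by
  induction k with
  | zero => norm_num [scale]
  | succ k ih => have := speed_pos k; simp only [scale]; positivity

lemma reach_pos (k : ℕ) : 0 < reach k := mul_pos (speed_pos k) (scale_pos k)

lemma isoTime_pos (k : ℕ) : 0 < isoTime k := div_pos (reach_pos k) (by norm_num)

lemma scale_succ (k : ℕ) : scale (k + 1) = reach k / 10000 := rfl

lemma reach_le_scale (k : ℕ) : reach k ≤ scale k / 100 := by
  have := mul_le_mul_of_nonneg_right (speed_le k) (scale_pos k).le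
  unfold reach; linarith

lemma scale_succ_le (k : ℕ) : scale (k + 1) ≤ scale k / 1000000 := by
  rw [scale_succ]; linarith [reach_le_scale k]

lemma scale_anti : Antitone scale :=
  antitone_nat_of_succ_le fun k => by linarith [scale_succ_le k, scale_pos k]

lemma speed_anti : Antitone speed :=
  antitone_nat_of_succ_le fun k => by rw [speed_succ]; linarith [speed_pos k]

lemma scale_le_reach {l k : ℕ} (h : l < k) : scale k ≤ reach l / 10000 := by
  rw [← scale_succ]; exact scale_anti h

lemma speed_le_of_lt {l k : ℕ} (h : l < k) : speed k ≤ speed l / 100 := by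
  rw [← speed_succ]; exact speed_anti h

lemma reach_le_of_lt {l k : ℕ} (h : l < k) : reach k ≤ reach l / 1000000 := by
  linarith [scale_le_reach h, reach_le_scale k]

lemma scale_le_isoTime {l k : ℕ} (h : l < k) : 4 * scale k ≤ isoTime l := by
  have := scale_le_reach h
  have := reach_pos l
  unfold isoTime; linarith

lemma isoTime_le_scale (k : ℕ) : isoTime k ≤ scale k / 10000 := by
  have := reach_le_scale k
  unfold isoTime; linarith

lemma scale_le_pow (k : ℕ) : scale k ≤ (1 / 2) ^ k := by
  induction k with
  | zero => norm_num [scale]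
  | succ k ih => rw [pow_succ]; linarith [scale_succ_le k, scale_pos k]

lemma exists_scale_lt {T : ℝ} (hT : 0 < T) : ∃ k, scale k < T := by
  obtain ⟨k, hk⟩ := exists_pow_lt_of_lt_one hT (by norm_num : (1 / 2 : ℝ) < 1)
  exact ⟨k, (scale_le_pow k).trans_lt hk⟩

/-! ### Weighted centers -/

section Center

variable {ι : Type*}

lemma tsum_lt_zero_of_nonpos {f : ι → ℝ} (hf : Summable f) (h : ∀ d, f d ≤ 0) {c : ι}
    (hc : f c < 0) : ∑' d, f d < 0 := by
  have := hf.tsum_lt_tsum (g := fun _ => (0 : ℝ)) h hc summable_zero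
  simpa using this

open Classical in
lemma summable_center {m : ι → ℝ} (hm : Summable m) (hpos : ∀ d, 0 < m d) (S : Set ι) {g : ι → ℝ}
    {B : ℝ} (hg : ∀ d, |g d| ≤ B) (z : ℝ) :
    Summable fun d => if d ∈ S then m d * (g d - z) else 0 := by
  refine Summable.of_norm_bounded (hm.mul_right (B + |z|)) fun d => ?_
  have h1 : |g d - z| ≤ B + |z| := (abs_sub _ _).trans (by linarith [hg d])
  have hB : 0 ≤ B + |z| := (abs_nonneg _).trans h1
  have := hpos d
  split_ifs
  · rw [Real.norm_eq_abs, abs_mul, abs_of_pos this]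
    gcongr
  · simpa using mul_nonneg this.le hB

open Classical in
/-- If `z` is the center of mass of `g` over `S`, then `z ≤ a` as soon as the moment of `g` about `a`
is nonpositive. -/
lemma center_le_of_moment {m : ι → ℝ} (hm : Summable m) (hpos : ∀ d, 0 < m d) {S : Set ι} {c : ι}
    (hc : c ∈ S) {g : ι → ℝ} {B : ℝ} (hg : ∀ d, |g d| ≤ B) {z a : ℝ}
    (hz : ∑' d, (if d ∈ S then m d * (g d - z) else 0) = 0)
    (ha : ∑' d, (if d ∈ S then m d * (g d - a) else 0) ≤ 0) : z ≤ a := by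
  by_contra! hlt
  have := (summable_center hm hpos S hg z).tsum_lt_tsum (i := c)
    (g := fun d => if d ∈ S then m d * (g d - a) else 0) (fun d => ?_) ?_
    (summable_center hm hpos S hg a)
  · linarith
  · have := hpos d
    simp only
    split_ifs
    · gcongr
    · rfl
  · have := hpos c
    simp only [hc, if_true]
    gcongr

open Classical in
lemma le_center_of_moment {m : ι → ℝ} (hm : Summable m) (hpos : ∀ d, 0 < m d) {S : Set ι} {c : ι}
    (hc : c ∈ S) {g : ι → ℝ} {B : ℝ} (hg : ∀ d, |g d| ≤ B) {z a : ℝ}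
    (hz : ∑' d, (if d ∈ S then m d * (g d - z) else 0) = 0)
    (ha : 0 ≤ ∑' d, (if d ∈ S then m d * (g d - a) else 0)) : a ≤ z := by
  have key := center_le_of_moment hm hpos hc (g := fun d => - g d) (z := -z) (a := -a) (B := B)
    (fun d => by simpa using hg d) ?_ ?_
  · linarith
  · have : (fun d => if d ∈ S then m d * (- g d - -z) else 0) =
        fun d => - (if d ∈ S then m d * (g d - z) else 0) := by
      funext d; split_ifs <;> ring
    rw [this, tsum_neg, hz, neg_zero]
  · have : (fun d => if d ∈ S then m d * (- g d - -a) else 0) =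
        fun d => - (if d ∈ S then m d * (g d - a) else 0) := by
      funext d; split_ifs <;> ring
    rw [this, tsum_neg]; linarith

open Classical in
lemma center_le {m : ι → ℝ} (hm : Summable m) (hpos : ∀ d, 0 < m d) {S : Set ι} {c : ι}
    (hc : c ∈ S) {g : ι → ℝ} {B : ℝ} (hg : ∀ d, |g d| ≤ B) {z a : ℝ}
    (hz : ∑' d, (if d ∈ S then m d * (g d - z) else 0) = 0) (ha : ∀ d ∈ S, g d ≤ a) : z ≤ a :=
  center_le_of_moment hm hpos hc hg hz <| tsum_nonpos fun d => by
    split_ifs with h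
    · exact mul_nonpos_of_nonneg_of_nonpos (hpos d).le (by linarith [ha d h])
    · rfl

open Classical in
lemma le_center {m : ι → ℝ} (hm : Summable m) (hpos : ∀ d, 0 < m d) {S : Set ι} {c : ι}
    (hc : c ∈ S) {g : ι → ℝ} {B : ℝ} (hg : ∀ d, |g d| ≤ B) {z a : ℝ}
    (hz : ∑' d, (if d ∈ S then m d * (g d - z) else 0) = 0) (ha : ∀ d ∈ S, a ≤ g d) : a ≤ z :=
  le_center_of_moment hm hpos hc hg hz <| tsum_nonneg fun d => by
    split_ifs with h
    · exact mul_nonneg (hpos d).le (by linarith [ha d h])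
    · rfl

open Classical in
/-- A sum whose term at `c` outweighs a bound for all other terms is nonpositive. -/
lemma tsum_nonpos_of_dominant {f u : ι → ℝ} (hf : Summable f) (hu : Summable u) (c : ι)
    (hle : ∀ d, d ≠ c → f d ≤ u d) (hc0 : 0 ≤ u c) (hc : f c + ∑' d, u d ≤ 0) : ∑' d, f d ≤ 0 := by
  have h1 : HasSum (fun d => u d + if d = c then f c else 0) (∑' d, u d + f c) :=
    hu.hasSum.add (hasSum_ite_eq c (f c))
  have h2 := hasSum_le (fun d => ?_) hf.hasSum h1
  · linarith
  · by_cases h : d = c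
    · subst h; simpa using hc0
    · simpa [h] using hle d h

end Center

/-- A continuous function bounded below to the left of a point is bounded below there. -/
lemma le_of_forall_Ioo_le {h : ℝ → ℝ} (hh : Continuous h) {a b δ : ℝ} (hab : a < b)
    (H : ∀ r, a < r → r < b → δ ≤ h r) : δ ≤ h b := by
  refine ge_of_tendsto (hh.continuousWithinAt (s := Iio b) (x := b)) ?_
  filter_upwards [Ioo_mem_nhdsLT hab] with r hr using H r hr.1 hr.2

lemma eq_of_forall_Ioo_eq {h : ℝ → ℝ} (hh : Continuous h) {a b z : ℝ} (hab : a < b)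
    (H : ∀ r, a < r → r < b → h r = z) : h b = z := by
  have h1 := le_of_forall_Ioo_le hh hab (δ := z) fun r hr hr' => (H r hr hr').ge
  have h2 := le_of_forall_Ioo_le hh.neg hab (δ := -z) fun r hr hr' => by simp [H r hr hr']
  simp only [Pi.neg_apply] at h2
  linarith

/-- Comparison with a geometric series. In the induction the reserve `2 * f n` pays for the next
term `f n` and for the next reserve, and the first reserve `2 * f (k + 1)` is at most `f k / 50`. -/
lemma tail_bound {f : ℕ → ℝ} (h0 : ∀ k, 0 ≤ f k) (h : ∀ k, f (k + 1) ≤ f k / 100) (k : ℕ) :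
    ∑' j, (if k < j then f j else 0) ≤ f k / 50 := by
  have key : ∀ n, ∑ j ∈ Finset.range n, (if k < j then f j else 0) +
      (if k < n then 2 * f n else 0) ≤ f k / 50 := by
    intro n
    induction n with
    | zero => simpa using div_nonneg (h0 k) (by norm_num : (0 : ℝ) ≤ 50)
    | succ n ih =>
      rw [Finset.sum_range_succ]
      have h1 := h n
      have h2 := h0 n
      by_cases hn : k < n
      · simp only [hn, if_true, hn.trans n.lt_succ_self] at ih ⊢
        linarith
      · simp only [hn, if_false] at ih ⊢
        split_ifs with h3
        · obtain rfl : k = n := le_antisymm (Nat.lt_succ_iff.1 h3) (not_lt.1 hn)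
          have h4 : ∑ j ∈ Finset.range k, (if k < j then f j else 0) = 0 :=
            Finset.sum_eq_zero fun j hj => if_neg (Finset.mem_range.1 hj).not_gt
          linarith
        · linarith
  refine Real.tsum_le_of_sum_range_le (fun j => by split_ifs; exacts [h0 j, le_rfl]) fun n => ?_
  have := key n
  have : 0 ≤ if k < n then 2 * f n else 0 := by
    split_ifs
    · linarith [h0 n]
    · rfl
  linarith

/-! ### Discrete sticky systems -/

/-- The level of a chunk; the chunks `inl k` form the axis, the chunks `inr k` come from above. -/
def level : ℕ ⊕ ℕ → ℕ := Sum.elim id id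

@[simp] lemma level_inl (k : ℕ) : level (Sum.inl k) = k := rfl
@[simp] lemma level_inr (k : ℕ) : level (Sum.inr k) = k := rfl

/-- Free motion of the chunks, the chunk `inr k` being aimed at `(y k, 0)` at time `2 * scale k`. -/
def free (y : ℕ → ℝ) : ℕ ⊕ ℕ → ℝ → ℝ × ℝ
  | Sum.inl k, t => (reach k - speed k * t, 0)
  | Sum.inr k, t => (y k, speed k * (2 * scale k - t))

@[simp] lemma free_inl_fst (y : ℕ → ℝ) (k : ℕ) (t : ℝ) :
    (free y (Sum.inl k) t).1 = reach k - speed k * t := rfl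
@[simp] lemma free_inl_snd (y : ℕ → ℝ) (k : ℕ) (t : ℝ) : (free y (Sum.inl k) t).2 = 0 := rfl
@[simp] lemma free_inr_fst (y : ℕ → ℝ) (k : ℕ) (t : ℝ) : (free y (Sum.inr k) t).1 = y k := rfl
@[simp] lemma free_inr_snd (y : ℕ → ℝ) (k : ℕ) (t : ℝ) :
    (free y (Sum.inr k) t).2 = speed k * (2 * scale k - t) := rfl

/-- The masses of the chunks decay rapidly. -/
structure IsMass (m : ℕ ⊕ ℕ → ℝ) : Prop where
  pos : ∀ d, 0 < m d
  summable : Summable m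
  inl_succ_le : ∀ k, m (Sum.inl (k + 1)) ≤ m (Sum.inl k) / 100
  inr_succ_le : ∀ k, m (Sum.inr (k + 1)) ≤ m (Sum.inr k) / 100
  inr_le_inl : ∀ k, m (Sum.inr k) ≤ m (Sum.inl k) / 100

/-- `y k` is the center of mass, at time `2 * scale k`, of the freely moving chunks `inl j`,
`k ≤ j`. -/
def IsTarget (m : ℕ ⊕ ℕ → ℝ) (y : ℕ → ℝ) : Prop :=
  ∀ k, ∑' j, (if k ≤ j then m (Sum.inl j) * (reach j - speed j * (2 * scale k) - y k) else 0) = 0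

open Classical in
/-- Positions `Z c t`, `0 ≤ t ≤ T`, of sticky chunks with masses `m` and free motions `free y`. -/
structure IsStickySystem (T : ℝ) (m : ℕ ⊕ ℕ → ℝ) (y : ℕ → ℝ) (Z : ℕ ⊕ ℕ → ℝ → ℝ × ℝ) :
    Prop where
  mass : IsMass m
  target : IsTarget m y
  lipschitz : ∀ c s t, dist (Z c s) (Z c t) ≤ |s - t|
  sticky : ∀ c d s t, 0 ≤ s → s ≤ t → t ≤ T → Z c s = Z d s → Z c t = Z d t
  isolated : ∀ c d t, 0 ≤ t → t ≤ T → t ≤ isoTime (level c) → d ≠ c →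
    isoTime (level c) ≤ dist (Z d t) (Z c t)
  center_fst : ∀ c t, 0 ≤ t → t ≤ T →
    ∑' d, (if d ∈ {d | Z d t = Z c t} then m d * ((free y d t).1 - (Z c t).1) else 0) = 0
  center_snd : ∀ c t, 0 ≤ t → t ≤ T →
    ∑' d, (if d ∈ {d | Z d t = Z c t} then m d * ((free y d t).2 - (Z c t).2) else 0) = 0

/-! ### Tails of the mass distribution and location of the targets -/

namespace IsMass

variable {m : ℕ ⊕ ℕ → ℝ} (hm : IsMass m)
include hm

lemma summable_ite (S : Set (ℕ ⊕ ℕ)) [DecidablePred (· ∈ S)] :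
    Summable fun d => if d ∈ S then m d else 0 :=
  hm.summable.of_nonneg_of_le (fun d => by split_ifs; exacts [(hm.pos d).le, le_rfl])
    fun d => by split_ifs; exacts [le_rfl, (hm.pos d).le]

open Classical in
lemma tail_inr (i : ℕ) :
    ∑' d, (if d ∈ Sum.inr '' Ioi i then m d else 0) ≤ m (Sum.inr i) / 50 := by
  rw [← Sum.inr_injective.tsum_eq]
  · simpa using tail_bound (fun k => (hm.pos (Sum.inr k)).le) hm.inr_succ_le i
  · intro d hd
    by_contra hd'
    refine hd (if_neg fun h => hd' ?_)
    obtain ⟨j, -, rfl⟩ := h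
    exact ⟨j, rfl⟩

open Classical in
lemma tail_inl (i : ℕ) :
    ∑' d, (if d ∈ Sum.inl '' Ioi i then m d else 0) ≤ m (Sum.inl i) / 50 := by
  rw [← Sum.inl_injective.tsum_eq]
  · simpa using tail_bound (fun k => (hm.pos (Sum.inl k)).le) hm.inl_succ_le i
  · intro d hd
    by_contra hd'
    refine hd (if_neg fun h => hd' ?_)
    obtain ⟨j, -, rfl⟩ := h
    exact ⟨j, rfl⟩

-- All particles of level at least `k` together weigh little compared with `inl k`; this is what
-- lets `inl k` dominate its clusters.
open Classical in
lemma tail_level (k : ℕ) :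
    ∑' d, (if d ∈ {d | k ≤ level d ∧ d ≠ Sum.inl k} then m d else 0) ≤ m (Sum.inl k) / 10 := by
  have h : (fun d => if d ∈ {d | k ≤ level d ∧ d ≠ Sum.inl k} then m d else 0) = fun d =>
      (if d ∈ Sum.inl '' Ioi k then m d else 0) + (if d ∈ Sum.inr '' Ioi k then m d else 0) +
        (if d = Sum.inr k then m (Sum.inr k) else 0) := by
    funext d
    rcases d with j | j
    · rcases lt_trichotomy j k with h | h | h
      · simp [h.not_ge, h.not_gt]
      · simp [h]
      · simp [h, h.le, h.ne']
    · rcases lt_trichotomy j k with h | h | h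
      · simp [h.not_ge, h.not_gt, h.ne]
      · simp [h]
      · simp [h, h.le, h.ne']
  rw [h]
  have h1 := (((hm.summable_ite (Sum.inl '' Ioi k)).hasSum.add
    (hm.summable_ite (Sum.inr '' Ioi k)).hasSum).add
      (hasSum_ite_eq (Sum.inr k) (m (Sum.inr k)))).tsum_eq
  rw [h1]
  have := hm.tail_inl k
  have := hm.tail_inr k
  have := hm.inr_le_inl k
  have := hm.pos (Sum.inl k)
  linarith

end IsMass

/-- At time `2 * scale k` the free `inl k` is at `-reach k`, whereas the slower `inl j`, `k < j`,
are still close to the origin. The mean therefore lies to the right of `-reach k`, but stays near it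
because `inl k` outweighs the others. -/
lemma IsMass.target_bounds {m : ℕ ⊕ ℕ → ℝ} (hm : IsMass m) {y : ℕ → ℝ} (hy : IsTarget m y)
    (k : ℕ) : -reach k ≤ y k ∧ y k ≤ -(reach k / 2) := by
  classical
  have hs : Summable fun j => m (Sum.inl j) := hm.summable.comp_injective Sum.inl_injective
  have hp : ∀ j, 0 < m (Sum.inl j) := fun j => hm.pos _
  have hk := reach_pos k
  have hr : reach k = speed k * scale k := rfl
  have hlow : ∀ j, k < j → -(reach k / 50) ≤ reach j - speed j * (2 * scale k) := fun j hj => by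
    have h1 := mul_le_mul_of_nonneg_right (speed_le_of_lt hj) (scale_pos k).le
    have := reach_pos j
    linarith
  have hB : ∀ j, |reach j - speed j * (2 * scale k)| ≤ 1 + 2 * scale k := fun j => by
    have h1 := mul_le_mul_of_nonneg_right (speed_le j) (scale_pos k).le
    have h2 := mul_pos (speed_pos j) (scale_pos k)
    have h3 := reach_le_scale j
    have h4 : scale j ≤ 1 := scale_anti (Nat.zero_le j)
    have h5 := reach_pos j
    have h6 := scale_pos k
    rw [abs_le]; constructor <;> linarith
  have hz : ∑' j, (if j ∈ Ici k then
      m (Sum.inl j) * (reach j - speed j * (2 * scale k) - y k) else 0) = 0 := by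
    simpa using hy k
  constructor
  · refine le_center hs hp (c := k) (self_mem_Ici) hB (by convert hz) fun j hj => ?_
    rcases (mem_Ici.1 hj).eq_or_lt with rfl | hj
    · linarith
    · linarith [hlow j hj]
  · refine center_le_of_moment hs hp (c := k) (self_mem_Ici) hB (by convert hz) ?_
    have htail := tail_bound (fun j => (hp j).le) hm.inl_succ_le k
    have hsu : Summable fun j => if k < j then m (Sum.inl j) else 0 :=
      hs.of_nonneg_of_le (fun d => by split_ifs; exacts [(hp d).le, le_rfl])
        fun d => by split_ifs; exacts [le_rfl, (hp d).le]
    refine tsum_nonpos_of_dominant (summable_center hs hp _ hB _)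
      (u := fun j => (if k < j then m (Sum.inl j) else 0) * reach k) (hsu.mul_right _) k
      (fun j hj => ?_) (by simp) ?_
    · rcases lt_or_gt_of_ne hj with h | h
      · simp [h.not_ge, h.not_gt]
      · simp only [mem_Ici, h.le, h, if_true]
        have := reach_le_of_lt h
        have := mul_pos (speed_pos j) (scale_pos k)
        have := hp j
        gcongr
        linarith
    · rw [tsum_mul_right]
      simp only [self_mem_Ici, if_true]
      have h1 := mul_le_mul_of_nonneg_right htail hk.le
      have h2 := mul_pos (hp k) hk
      have h3 : reach k - speed k * (2 * scale k) - -(reach k / 2) = -(reach k / 2) := by linarith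
      rw [h3]; linarith

lemma abs_free_snd_le (y : ℕ → ℝ) (d : ℕ ⊕ ℕ) {t : ℝ} (ht : 0 ≤ t) : |(free y d t).2| ≤ 2 + t := by
  rcases d with k | k
  · simp; linarith
  · have h1 := mul_le_mul_of_nonneg_right (speed_le k) ht
    have h2 := mul_nonneg (speed_pos k).le ht
    have h3 := reach_le_scale k
    have h4 : scale k ≤ 1 := scale_anti (Nat.zero_le k)
    have h5 := reach_pos k
    have h6 : reach k = speed k * scale k := rfl
    rw [free_inr_snd, abs_le]; constructor <;> linarith

lemma snd_le_dist (Z : ℕ ⊕ ℕ → ℝ → ℝ × ℝ) (c d : ℕ ⊕ ℕ) (t : ℝ) : |(Z d t).2 - (Z c t).2| ≤ dist (Z d t) (Z c t) := by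
  rw [Prod.dist_eq, Real.dist_eq, Real.dist_eq]; exact le_max_right _ _

lemma fst_le_dist (Z : ℕ ⊕ ℕ → ℝ → ℝ × ℝ) (c d : ℕ ⊕ ℕ) (t : ℝ) : |(Z d t).1 - (Z c t).1| ≤ dist (Z d t) (Z c t) := by
  rw [Prod.dist_eq, Real.dist_eq, Real.dist_eq]; exact le_max_left _ _

/-! ### Free motion, isolation, and the undisturbed fall to the target -/

namespace IsStickySystem

variable {T : ℝ} {m : ℕ ⊕ ℕ → ℝ} {y : ℕ → ℝ} {Z : ℕ ⊕ ℕ → ℝ → ℝ × ℝ}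
  (h : IsStickySystem T m y Z)
include h

lemma continuous (c : ℕ ⊕ ℕ) : Continuous (Z c) :=
  (LipschitzWith.of_dist_le_mul (K := 1) fun s t => by
    simpa [Real.dist_eq] using h.lipschitz c s t).continuous

lemma target_le (k : ℕ) : y k ≤ -(reach k / 2) := (h.mass.target_bounds h.target k).2
lemma le_target (k : ℕ) : -reach k ≤ y k := (h.mass.target_bounds h.target k).1

lemma abs_free_fst_le (d : ℕ ⊕ ℕ) {t : ℝ} (ht : 0 ≤ t) : |(free y d t).1| ≤ 1 + t := by
  rcases d with k | k
  · have h1 := mul_le_mul_of_nonneg_right (speed_le k) ht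
    have h2 := mul_nonneg (speed_pos k).le ht
    have h3 := reach_le_scale k
    have h4 : scale k ≤ 1 := scale_anti (Nat.zero_le k)
    have h5 := reach_pos k
    rw [free_inl_fst, abs_le]; constructor <;> linarith
  · have h1 := h.target_le k
    have h2 := h.le_target k
    have h3 := reach_le_scale k
    have h4 : scale k ≤ 1 := scale_anti (Nat.zero_le k)
    have h5 := reach_pos k
    rw [free_inr_fst, abs_le]; constructor <;> linarith

/-- A cluster sits at a convex combination of the free positions of its members, so a common bound
on these passes to the cluster. -/
lemma snd_le {c : ℕ ⊕ ℕ} {t a : ℝ} (ht : 0 ≤ t) (htT : t ≤ T)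
    (H : ∀ d, Z d t = Z c t → (free y d t).2 ≤ a) : (Z c t).2 ≤ a := by
  classical
  exact center_le h.mass.summable h.mass.pos (S := {d | Z d t = Z c t}) (c := c) rfl
    (fun d => abs_free_snd_le y d ht) (by convert h.center_snd c t ht htT) H

lemma le_snd {c : ℕ ⊕ ℕ} {t a : ℝ} (ht : 0 ≤ t) (htT : t ≤ T)
    (H : ∀ d, Z d t = Z c t → a ≤ (free y d t).2) : a ≤ (Z c t).2 := by
  classical
  exact le_center h.mass.summable h.mass.pos (S := {d | Z d t = Z c t}) (c := c) rfl
    (fun d => abs_free_snd_le y d ht) (by convert h.center_snd c t ht htT) H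

lemma fst_le {c : ℕ ⊕ ℕ} {t a : ℝ} (ht : 0 ≤ t) (htT : t ≤ T)
    (H : ∀ d, Z d t = Z c t → (free y d t).1 ≤ a) : (Z c t).1 ≤ a := by
  classical
  exact center_le h.mass.summable h.mass.pos (S := {d | Z d t = Z c t}) (c := c) rfl
    (fun d => h.abs_free_fst_le d ht) (by convert h.center_fst c t ht htT) H

lemma le_fst {c : ℕ ⊕ ℕ} {t a : ℝ} (ht : 0 ≤ t) (htT : t ≤ T)
    (H : ∀ d, Z d t = Z c t → a ≤ (free y d t).1) : a ≤ (Z c t).1 := by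
  classical
  exact le_center h.mass.summable h.mass.pos (S := {d | Z d t = Z c t}) (c := c) rfl
    (fun d => h.abs_free_fst_le d ht) (by convert h.center_fst c t ht htT) H

/-- A chunk which has not met any other moves freely. -/
lemma eq_free {c : ℕ ⊕ ℕ} {t : ℝ} (ht : 0 ≤ t) (htT : t ≤ T) (H : ∀ d, d ≠ c → Z d t ≠ Z c t) :
    Z c t = free y c t := by
  have H' : ∀ d, Z d t = Z c t → d = c := fun d hd => by_contra fun hne => H d hne hd
  refine Prod.ext (le_antisymm ?_ ?_) (le_antisymm ?_ ?_)
  · exact h.fst_le ht htT fun d hd => by rw [H' d hd]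
  · exact h.le_fst ht htT fun d hd => by rw [H' d hd]
  · exact h.snd_le ht htT fun d hd => by rw [H' d hd]
  · exact h.le_snd ht htT fun d hd => by rw [H' d hd]

lemma ne_of_le_isoTime {c d : ℕ ⊕ ℕ} {t : ℝ} (ht : 0 ≤ t) (htT : t ≤ T)
    (htc : t ≤ isoTime (level c)) (hd : d ≠ c) : Z d t ≠ Z c t := fun he => by
  have := h.isolated c d t ht htT htc hd
  rw [he, dist_self] at this
  exact absurd (isoTime_pos (level c)) this.not_gt

/-- Before level `k - 1` is active, chunks of level at least `k` meet only chunks of level at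
least `k`. -/
lemma le_level {c d : ℕ ⊕ ℕ} {t : ℝ} {k : ℕ} (ht : 0 ≤ t) (htT : t ≤ T) (htk : t ≤ 4 * scale k)
    (hc : k ≤ level c) (hd : Z d t = Z c t) : k ≤ level d := by
  by_contra! hlt
  refine h.ne_of_le_isoTime (c := d) (d := c) ht htT (htk.trans (scale_le_isoTime hlt)) ?_ hd.symm
  rintro rfl
  omega

/-- A chunk remains alone as long as it keeps a positive distance to all others. -/
lemma alone_of_gap {c : ℕ ⊕ ℕ} {e : ℝ}
    (H : ∀ τ, 0 ≤ τ → τ < e → (∀ r, 0 ≤ r → r < τ → ∀ d, d ≠ c → Z d r ≠ Z c r) →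
      ∃ δ > 0, ∀ d, d ≠ c → δ ≤ dist (Z d τ) (Z c τ)) :
    ∀ r, 0 ≤ r → r < e → ∀ d, d ≠ c → Z d r ≠ Z c r := by
  by_contra! hcon
  obtain ⟨r₀, hr₀, hr₀e, d₀, hd₀, hZ₀⟩ := hcon
  set B : Set ℝ := {r | 0 ≤ r ∧ ∃ d, d ≠ c ∧ Z d r = Z c r}
  have hB : r₀ ∈ B := ⟨hr₀, d₀, hd₀, hZ₀⟩
  have hbdd : BddBelow B := ⟨0, fun r hr => hr.1⟩
  have h0 : 0 ≤ sInf B := le_csInf ⟨r₀, hB⟩ fun r hr => hr.1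
  -- With infinitely many particles the infimum of the meeting times need not be attained, so a gap
  -- uniform in `d` is required there. Since paths are 1-Lipschitz, it excludes meetings during a
  -- further time `δ / 2`.
  obtain ⟨δ, hδ, hgap⟩ := H (sInf B) h0 ((csInf_le hbdd hB).trans_lt hr₀e)
    fun r hr hrB d hd he => (csInf_le hbdd ⟨hr, d, hd, he⟩).not_gt hrB
  obtain ⟨r, hr, hrδ⟩ := exists_lt_of_csInf_lt ⟨r₀, hB⟩
    (show sInf B < sInf B + δ / 2 by linarith)
  have hle := csInf_le hbdd hr
  obtain ⟨-, d, hd, he⟩ := hr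
  have h1 := h.lipschitz d (sInf B) r
  have h2 := h.lipschitz c r (sInf B)
  have h3 := hgap d hd
  have h4 := dist_triangle4 (Z d (sInf B)) (Z d r) (Z c r) (Z c (sInf B))
  rw [he, dist_self] at h4
  rw [abs_sub_comm, abs_of_nonneg (by linarith)] at h1
  rw [abs_of_nonneg (by linarith)] at h2
  rw [he] at h1
  linarith

/-- A chunk which has been alone up to time `τ` moves freely up to and including time `τ`. -/
lemma eq_free_of_alone {c : ℕ ⊕ ℕ} {τ : ℝ} (hτ : 0 < τ) (hτT : τ ≤ T)
    (H : ∀ r, 0 ≤ r → r < τ → ∀ d, d ≠ c → Z d r ≠ Z c r) : Z c τ = free y c τ := by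
  have key : ∀ r, 0 < r → r < τ → Z c r = free y c r := fun r hr hrτ =>
    h.eq_free hr.le (hrτ.le.trans hτT) (H r hr.le hrτ)
  have hcont : Continuous (free y c) := by
    rcases c with k | k
    · exact (by fun_prop : Continuous fun t => (reach k - speed k * t, (0 : ℝ)))
    · exact (by fun_prop : Continuous fun t => (y k, speed k * (2 * scale k - t)))
  have h1 := eq_of_forall_Ioo_eq (h := fun r => (Z c r).1 - (free y c r).1) (z := 0)
    (((h.continuous c).fst).sub hcont.fst) hτ fun r hr hr' => by rw [key r hr hr', sub_self]
  have h2 := eq_of_forall_Ioo_eq (h := fun r => (Z c r).2 - (free y c r).2) (z := 0)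
    (((h.continuous c).snd).sub hcont.snd) hτ fun r hr hr' => by rw [key r hr hr', sub_self]
  exact Prod.ext (sub_eq_zero.1 h1) (sub_eq_zero.1 h2)

/-- The chunk `inr i` keeps a positive distance to all others before time `2 * scale i`. -/
lemma gap_before {i : ℕ} {τ : ℝ} (hτ : 0 ≤ τ) (hτi : τ < 2 * scale i) (hτT : τ ≤ T)
    (H : ∀ r, 0 ≤ r → r < τ → ∀ d, d ≠ Sum.inr i → Z d r ≠ Z (Sum.inr i) r) :
    ∃ δ > 0, ∀ d, d ≠ Sum.inr i → δ ≤ dist (Z d τ) (Z (Sum.inr i) τ) := by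
  have hs := scale_pos i
  rcases le_or_gt τ (isoTime i) with hi | hi
  · exact ⟨isoTime i, isoTime_pos i, fun d hd => h.isolated (Sum.inr i) d τ hτ hτT hi hd⟩
  have hi0 := isoTime_pos i
  have hε : 0 < speed i * (2 * scale i - τ) := mul_pos (speed_pos i) (by linarith)
  refine ⟨min (isoTime i) (speed i * (2 * scale i - τ)), lt_min hi0 hε, fun d hd => ?_⟩
  rcases lt_or_ge (level d) i with hl | hl
  · refine (min_le_left _ _).trans ?_
    have h1 := scale_le_isoTime hl
    have h2 := h.isolated d (Sum.inr i) τ hτ hτT (by linarith) (Ne.symm hd)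
    rw [dist_comm] at h2
    linarith [isoTime_le_scale i]
  · refine (min_le_right _ _).trans (le_trans ?_ (snd_le_dist Z _ _ τ))
    rw [abs_sub_comm]
    refine le_trans ?_ (le_abs_self _)
    -- Aloneness is known only strictly before `τ`. There every other cluster of level at least `i`
    -- lies on or below the axis and `inr i` strictly above it; the bound passes to `τ` by
    -- continuity.
    refine le_of_forall_Ioo_le (h := fun r => (Z (Sum.inr i) r).2 - (Z d r).2) (by
      have := h.continuous (Sum.inr i); have := h.continuous d; fun_prop) hi fun r hr hrτ => ?_
    have hr0 : 0 ≤ r := by linarith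
    rw [h.eq_free hr0 (by linarith) (H r hr0 hrτ), free_inr_snd]
    have h1 : (Z d r).2 ≤ 0 := by
      refine h.snd_le hr0 (by linarith) fun d' hd' => ?_
      have hl' := h.le_level (k := i) hr0 (by linarith) (by linarith) hl hd'
      have hne : d' ≠ Sum.inr i := by
        rintro rfl
        exact H r hr0 hrτ d hd hd'.symm
      rcases d' with j | j
      · simp
      · have hij : i < j := lt_of_le_of_ne hl' fun e => hne (by rw [e])
        have := scale_le_isoTime hij
        have := scale_pos j
        rw [free_inr_snd]
        exact mul_nonpos_of_nonneg_of_nonpos (speed_pos j).le (by linarith)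
    have h2 : speed i * (2 * scale i - τ) ≤ speed i * (2 * scale i - r) :=
      mul_le_mul_of_nonneg_left (by linarith) (speed_pos i).le
    linarith

/-- Unconditional, unlike what happens after the crossing: lower levels are still isolated, and the
higher levels are no longer above the axis once `inr i` leaves its own isolation phase. -/
lemma alone_before {i : ℕ} (hi : 2 * scale i ≤ T) :
    ∀ r, 0 ≤ r → r < 2 * scale i → ∀ d, d ≠ Sum.inr i → Z d r ≠ Z (Sum.inr i) r :=
  h.alone_of_gap fun _ hτ hτi H => h.gap_before hτ hτi (hτi.le.trans hi) H

end IsStickySystem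

/-- For `k < j` the crossing time `2 * scale j` precedes `isoTime k`, so in free motion only `inr k`
can still be above the axis. -/
lemma free_snd_nonpos (y : ℕ → ℝ) {k : ℕ} {d : ℕ ⊕ ℕ} {r : ℝ} (hr : isoTime k < r) (hd : k ≤ level d)
    (hk : d ≠ Sum.inr k ∨ 2 * scale k ≤ r) : (free y d r).2 ≤ 0 := by
  rcases d with j | j
  · simp
  · rw [free_inr_snd]
    refine mul_nonpos_of_nonneg_of_nonpos (speed_pos j).le ?_
    rcases (show k ≤ j from hd).eq_or_lt with rfl | hkj
    · rcases hk with hk | hk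
      · exact absurd rfl hk
      · linarith
    · have := scale_le_isoTime hkj
      have := scale_pos j
      linarith

/-! ### The particle `inl k` meets no small falling particle before `inr k` -/

namespace IsStickySystem

variable {T : ℝ} {m : ℕ ⊕ ℕ → ℝ} {y : ℕ → ℝ} {Z : ℕ ⊕ ℕ → ℝ → ℝ × ℝ}
  (h : IsStickySystem T m y Z)
include h

lemma inr_le_of_lt {k i : ℕ} (hki : k < i) : m (Sum.inr i) ≤ m (Sum.inl k) / 10000 := by
  have h1 : m (Sum.inr i) ≤ m (Sum.inr (k + 1)) :=
    antitone_nat_of_succ_le (f := fun j => m (Sum.inr j))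
      (fun j => by linarith [h.mass.inr_succ_le j, h.mass.pos (Sum.inr j)]) hki
  linarith [h.mass.inr_succ_le k, h.mass.inr_le_inl k]

/-- As long as `inl k` has met only the axis and chunks `inr j`, `i < j`, its cluster is
essentially on the axis. -/
lemma le_snd_of_tail {k i : ℕ} {r : ℝ} (hr : 0 ≤ r) (hrT : r ≤ T)
    (H : ∀ j, Z (Sum.inr j) r = Z (Sum.inl k) r → i < j) :
    -(m (Sum.inr i) * speed i / m (Sum.inl k) * r / 5000) ≤ (Z (Sum.inl k) r).2 := by
  classical
  have hmk := h.mass.pos (Sum.inl k)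
  have hmi := h.mass.pos (Sum.inr i)
  have hε := speed_pos i
  set a := -(m (Sum.inr i) * speed i / m (Sum.inl k) * r / 5000) with ha
  have ha0 : a ≤ 0 := by rw [ha, neg_nonpos]; positivity
  refine le_center_of_moment h.mass.summable h.mass.pos (S := {d | Z d r = Z (Sum.inl k) r})
    (c := Sum.inl k) rfl (fun d => abs_free_snd_le y d hr)
    (by convert h.center_snd (Sum.inl k) r hr hrT) ?_
  rw [← neg_nonpos, ← tsum_neg]
  -- The particles `inr j`, `i < j`, weigh at most `m (inr i) / 50` in total and have fallen at most
  -- `speed i / 100 * r` below the axis; the product gives the constant `1 / 5000`.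
  refine tsum_nonpos_of_dominant (c := Sum.inl k)
    (u := fun d => (if d ∈ Sum.inr '' Ioi i then m d else 0) * (speed i / 100 * r))
    (summable_center h.mass.summable h.mass.pos _ (fun d => abs_free_snd_le y d hr) a).neg
    ((h.mass.summable_ite _).mul_right _) (fun d hd => ?_) (by simp) ?_
  · have hmd := h.mass.pos d
    have hu : 0 ≤ (if d ∈ Sum.inr '' Ioi i then m d else 0) * (speed i / 100 * r) := by
      split_ifs
      · positivity
      · simp
    split_ifs with hS hi hi
    · obtain ⟨j, hj, rfl⟩ := hi
      rw [free_inr_snd, neg_le, ← mul_neg]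
      refine mul_le_mul_of_nonneg_left ?_ hmd.le
      have h1 := mul_le_mul_of_nonneg_right (speed_le_of_lt (mem_Ioi.1 hj)) hr
      have h2 := mul_pos (speed_pos j) (scale_pos j)
      linarith
    · rcases d with j | j
      · rw [free_inl_snd]
        have := mul_nonneg hmd.le (neg_nonneg.2 ha0)
        linarith
      · exact absurd ⟨j, H j hS, rfl⟩ hi
    · rw [neg_zero]; positivity
    · simp
  · rw [tsum_mul_right]
    have htail := mul_le_mul_of_nonneg_right (h.mass.tail_inr i)
      (show 0 ≤ speed i / 100 * r by positivity)
    rw [if_pos (show Sum.inl k ∈ {d | Z d r = Z (Sum.inl k) r} from rfl), free_inl_snd, zero_sub]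
    have h2 : m (Sum.inl k) * a = - (m (Sum.inr i) * speed i * r / 5000) := by
      rw [ha]; field_simp
    linarith

/-- A cluster containing `inr i` but not `inl k`, `k < i`, has been carried away from the axis. -/
lemma snd_le_of_mem {k i : ℕ} {r : ℝ} (hki : k < i) (hr : isoTime k < r) (hrk : r ≤ 4 * scale k)
    (hrT : r ≤ T) (hne : Z (Sum.inl k) r ≠ Z (Sum.inr i) r)
    (hk : Z (Sum.inr k) r ≠ Z (Sum.inr i) r ∨ 2 * scale k ≤ r) :
    (Z (Sum.inr i) r).2 ≤ -(m (Sum.inr i) * speed i / m (Sum.inl k) * r) := by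
  classical
  have hmk := h.mass.pos (Sum.inl k)
  have hmi := h.mass.pos (Sum.inr i)
  have hε := speed_pos i
  have hr0 : 0 ≤ r := (isoTime_pos k).le.trans hr.le
  set b := m (Sum.inr i) * speed i / m (Sum.inl k) * r with hb
  have hb0 : 0 ≤ b := by positivity
  refine center_le_of_moment h.mass.summable h.mass.pos (S := {d | Z d r = Z (Sum.inr i) r})
    (c := Sum.inr i) rfl (fun d => abs_free_snd_le y d hr0)
    (by convert h.center_snd (Sum.inr i) r hr0 hrT) ?_
  -- All other members pull downwards or lie on the axis, and together weigh at most `m (inl k) /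
  -- 10`. Since `4 * scale i < r`, the free `inr i` is already at least `speed i * r / 2` below the
  -- axis, which suffices to drag the cluster down by `b`.
  refine tsum_nonpos_of_dominant (c := Sum.inr i)
    (u := fun d => (if d ∈ {d | k ≤ level d ∧ d ≠ Sum.inl k} then m d else 0) * b)
    (summable_center h.mass.summable h.mass.pos _ (fun d => abs_free_snd_le y d hr0) _)
    ((h.mass.summable_ite _).mul_right _) (fun d hd => ?_) ?_ ?_
  · have hmd := h.mass.pos d
    by_cases hS : Z d r = Z (Sum.inr i) r
    · have hl : k ≤ level d := h.le_level (c := Sum.inr i) hr0 hrT hrk hki.le hS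
      have hdk : d ≠ Sum.inl k := by rintro rfl; exact hne hS
      have hf : (free y d r).2 ≤ 0 := free_snd_nonpos y hr hl (by
        rcases hk with hk | hk
        · left; rintro rfl; exact hk hS
        · exact Or.inr hk)
      simp only [mem_ofPred_eq, hS, hl, hdk, if_true, ne_eq, not_false_eq_true, and_self]
      exact mul_le_mul_of_nonneg_left (by linarith) hmd.le
    · simp only [mem_ofPred_eq, hS, if_false]
      split_ifs
      · positivity
      · simp
  · split_ifs
    · positivity
    · simp
  · rw [tsum_mul_right]
    have htail := mul_le_mul_of_nonneg_right (h.mass.tail_level k) hb0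
    have hs := scale_le_isoTime hki
    have h1 := mul_le_mul_of_nonneg_right (h.inr_le_of_lt hki) hb0
    have h2 : m (Sum.inl k) * b = m (Sum.inr i) * speed i * r := by
      rw [hb]; field_simp
    have h3 : m (Sum.inr i) * speed i * (2 * scale i) ≤ m (Sum.inr i) * speed i * (r / 2) :=
      mul_le_mul_of_nonneg_left (by linarith) (by positivity)
    have h4 : 0 ≤ m (Sum.inr i) * speed i * r := by positivity
    rw [if_pos (show Sum.inr i ∈ {d | Z d r = Z (Sum.inr i) r} from rfl), free_inr_snd]
    linarith

/-- Until it meets `inr k`, the chunk `inl k` meets only chunks on the axis. -/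
lemma inl_ne_inr {k : ℕ} {τ : ℝ} (hτk : τ ≤ 4 * scale k) (hτT : τ ≤ T) (hkT : 2 * scale k ≤ T)
    (H : ∀ r, 0 ≤ r → r < τ → Z (Sum.inl k) r ≠ Z (Sum.inr k) r) {i : ℕ} (hki : k < i) :
    ∀ r, 0 ≤ r → r < τ → Z (Sum.inr i) r ≠ Z (Sum.inl k) r := by
  classical
  by_contra! hcon
  -- Minimal counterexample: the least `i > k` whose `inr i` meets `inl k` before `τ`, hence the
  -- heaviest offender, together with the first time `θ` at which these two meet.
  have hex : ∃ i, k < i ∧ ∃ r, 0 ≤ r ∧ r < τ ∧ Z (Sum.inr i) r = Z (Sum.inl k) r := ⟨i, hki, hcon⟩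
  clear hcon hki i
  obtain ⟨hki, r₀, hr₀, hr₀τ, hZ₀⟩ := Nat.find_spec hex
  have hmin := fun {j} => Nat.find_min (m := j) hex
  generalize Nat.find hex = i at *
  set B : Set ℝ := {r | 0 ≤ r ∧ Z (Sum.inr i) r = Z (Sum.inl k) r}
  have hBc : IsClosed B :=
    isClosed_Ici.inter (isClosed_eq (h.continuous (Sum.inr i)) (h.continuous (Sum.inl k)))
  have hbdd : BddBelow B := ⟨0, fun r hr => hr.1⟩
  have hB : r₀ ∈ B := ⟨hr₀, hZ₀⟩
  obtain ⟨hθ0, hθ⟩ := hBc.csInf_mem ⟨r₀, hB⟩ hbdd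
  have hθle := csInf_le hbdd hB
  have hlt : ∀ r, 0 ≤ r → r < sInf B → Z (Sum.inr i) r ≠ Z (Sum.inl k) r := fun r hr hrB he =>
    (csInf_le hbdd ⟨hr, he⟩).not_gt hrB
  set θ := sInf B
  have hiso : isoTime k < θ := by
    by_contra! hle
    exact h.ne_of_le_isoTime (c := Sum.inl k) hθ0 (by linarith) hle (by simp) hθ
  have hk0 := isoTime_pos k
  have hmk := h.mass.pos (Sum.inl k)
  have hmi := h.mass.pos (Sum.inr i)
  have hε := speed_pos i
  -- Before `θ`, minimality leaves only `inr j` with `i < j` in the cluster of `inl k`, so it sags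
  -- by at most `1 / 5000` of the depth already reached by the cluster of `inr i`. The vertical gap
  -- survives the limit at `θ`, contradicting the meeting.
  have hgap := le_of_forall_Ioo_le
    (h := fun r => (Z (Sum.inl k) r).2 - (Z (Sum.inr i) r).2)
    (δ := m (Sum.inr i) * speed i / m (Sum.inl k) * isoTime k / 2)
    ((h.continuous (Sum.inl k)).snd.sub (h.continuous (Sum.inr i)).snd) hiso
    fun r hr hrθ => by
      have hr0 : 0 ≤ r := by linarith
      have h1 := h.le_snd_of_tail (k := k) (i := i) hr0 (by linarith) fun j hj => by
        have hkj : k ≤ j :=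
          h.le_level (c := Sum.inl k) (d := Sum.inr j) hr0 (by linarith) (by linarith) le_rfl hj
        have hkj' : k ≠ j := by
          rintro rfl
          exact H r hr0 (by linarith) hj.symm
        have hij : i ≠ j := by
          rintro rfl
          exact hlt r hr0 hrθ hj
        by_contra! hji
        exact hmin (lt_of_le_of_ne hji hij.symm)
          ⟨lt_of_le_of_ne hkj hkj', r, hr0, by linarith, hj⟩
      have h2 := h.snd_le_of_mem hki hr (by linarith) (by linarith)
        (hlt r hr0 hrθ).symm (by
          rcases lt_or_ge r (2 * scale k) with hlt | hge
          · left
            exact (h.alone_before hkT r hr0 hlt (Sum.inr i) (by simpa using hki.ne')).symm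
          · exact Or.inr hge)
      have h3 : m (Sum.inr i) * speed i / m (Sum.inl k) * isoTime k ≤
        m (Sum.inr i) * speed i / m (Sum.inl k) * r := by gcongr
      have h4 : 0 ≤ m (Sum.inr i) * speed i / m (Sum.inl k) * isoTime k := by positivity
      linarith
  have hpos : 0 < m (Sum.inr i) * speed i / m (Sum.inl k) * isoTime k / 2 := by positivity
  rw [hθ, sub_self] at hgap
  linarith

end IsStickySystem

/-! ### The two effects of collisions at higher levels -/

namespace IsStickySystem

variable {T : ℝ} {m : ℕ ⊕ ℕ → ℝ} {y : ℕ → ℝ} {Z : ℕ ⊕ ℕ → ℝ → ℝ × ℝ}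
  (h : IsStickySystem T m y Z)
include h

lemma inr_eq_target {k : ℕ} (hk : 2 * scale k ≤ T) : Z (Sum.inr k) (2 * scale k) = (y k, 0) := by
  have := scale_pos k
  rw [h.eq_free_of_alone (by linarith) hk (h.alone_before hk)]
  simp [free]

/-- A collision at the target of level `k` excludes collisions at the targets of higher levels. -/
lemma ne_of_collision {k : ℕ} (hk : 2 * scale k ≤ T)
    (hE : Z (Sum.inl k) (2 * scale k) = Z (Sum.inr k) (2 * scale k)) {j : ℕ} (hkj : k < j) :
    Z (Sum.inl j) (2 * scale j) ≠ Z (Sum.inr j) (2 * scale j) := by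
  classical
  have hs := scale_pos k
  have ht0 : 0 ≤ 2 * scale k := by linarith
  have hZ := h.inr_eq_target hk
  set t := 2 * scale k with ht
  have hlev : ∀ {d}, Z d t = Z (Sum.inr k) t → k ≤ level d := fun hd =>
    h.le_level (c := Sum.inr k) ht0 hk (by linarith) le_rfl hd
  -- The cluster at the target has height `0` and no member with positive free height, so a member
  -- with negative free height would violate the center of mass identity.
  have hinr : ∀ j, k < j → Z (Sum.inr j) t ≠ Z (Sum.inr k) t := by
    intro j hj hjk
    have hneg : speed j * (2 * scale j - t) < 0 := by
      have := scale_le_isoTime hj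
      have := isoTime_le_scale k
      have := scale_pos j
      exact mul_neg_of_pos_of_neg (speed_pos j) (by linarith)
    refine (tsum_lt_zero_of_nonpos (c := Sum.inr j) (summable_center h.mass.summable h.mass.pos
      {d | Z d t = Z (Sum.inr k) t} (fun d => abs_free_snd_le y d ht0) (Z (Sum.inr k) t).2)
      (fun d => ?_) ?_).ne (by convert h.center_snd (Sum.inr k) t ht0 hk)
    · split_ifs with hd
      · refine mul_nonpos_of_nonneg_of_nonpos (h.mass.pos d).le ?_
        have := free_snd_nonpos y (k := k) (d := d) (r := t)
          (by linarith [isoTime_le_scale k]) (hlev hd) (Or.inr le_rfl)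
        rw [hZ]; simpa using this
      · rfl
    · rw [if_pos (show Sum.inr j ∈ {d | Z d t = Z (Sum.inr k) t} from hjk), hZ, free_inr_snd, sub_zero]
      exact mul_neg_of_pos_of_neg (h.mass.pos _) hneg
  have hp : ∀ j, 0 < m (Sum.inl j) := fun j => h.mass.pos _
  have hsm : Summable fun j => m (Sum.inl j) := h.mass.summable.comp_injective Sum.inl_injective
  have hB : ∀ j, |(free y (Sum.inl j) t).1| ≤ 1 + t := fun j => h.abs_free_fst_le _ ht0
  obtain ⟨S, hS⟩ : ∃ S : Set ℕ, ∀ j, j ∈ S ↔ Z (Sum.inl j) t = Z (Sum.inr k) t :=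
    ⟨_, fun _ => Iff.rfl⟩
  obtain ⟨U, hU⟩ : ∃ U : Set ℕ, ∀ j, j ∈ U ↔ k ≤ j := ⟨_, fun _ => Iff.rfl⟩
  have h1 : ∑' j, (if j ∈ S then
      m (Sum.inl j) * ((free y (Sum.inl j) t).1 - y k) else 0) = 0 := by
    -- The member `inr k` can be dropped from the sum: its free abscissa is exactly `y k`.
    refine Eq.trans ?_ ((Sum.inl_injective.tsum_eq (f := fun d =>
      if d ∈ {d | Z d t = Z (Sum.inr k) t} then
        m d * ((free y d t).1 - (Z (Sum.inr k) t).1) else 0) ?_).trans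
          (by convert h.center_fst (Sum.inr k) t ht0 hk))
    · refine tsum_congr fun j => ?_
      simp only [hS, hZ, mem_ofPred_eq]
    · intro d hd
      rcases d with j | j
      · exact ⟨j, rfl⟩
      · refine absurd ?_ hd
        simp only [mem_ofPred_eq, ite_eq_right_iff]
        intro hj
        have hkj : k ≤ j := hlev hj
        rcases hkj.eq_or_lt with rfl | hkj
        · rw [hZ]; simp
        · exact absurd hj (hinr j hkj)
  have h2 : ∑' j, (if j ∈ U then
      m (Sum.inl j) * ((free y (Sum.inl j) t).1 - y k) else 0) = 0 := by
    simpa [hU] using h.target k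
  -- Both the members `inl j` and the full family `k ≤ j` have mean `y k`. Every `inl j` with `k <
  -- j` has free position strictly to the right of `y k`, so omitting one would change the moment;
  -- `inl k` itself belongs by `hE`.
  have hall : ∀ j, k < j → Z (Sum.inl j) t = Z (Sum.inr k) t := by
    by_contra! hcon
    obtain ⟨j, hj, hjk⟩ := hcon
    have hgt : ∀ j, k < j → 0 < (free y (Sum.inl j) t).1 - y k := fun j hj => by
      have h3 := mul_le_mul_of_nonneg_right (speed_le_of_lt hj) hs.le
      have h4 : reach k = speed k * scale k := rfl
      have := reach_pos j
      have := reach_pos k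
      have := h.target_le k
      rw [free_inl_fst]; linarith
    refine (Summable.tsum_lt_tsum (i := j) ?_ ?_
      (summable_center hsm hp S hB (y k))
      (summable_center hsm hp U hB (y k))).ne (h1.trans h2.symm)
    · intro i
      by_cases hi : Z (Sum.inl i) t = Z (Sum.inr k) t
      · have : k ≤ i := hlev hi
        simp [hi, this, hS, hU]
      · simp only [hS, hi, if_false, hU]
        split_ifs with hki
        · have hne : k ≠ i := by rintro rfl; exact hi hE
          exact mul_nonneg (hp i).le (hgt i (lt_of_le_of_ne hki hne)).le
        · rfl
    · simp only [hS, hjk, if_false, hU, hj.le, if_true]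
      exact mul_pos (hp j) (hgt j hj)
  intro hEj
  have hjs := scale_le_isoTime hkj
  have hjs' := isoTime_le_scale k
  have := scale_pos j
  have := h.sticky _ _ _ t (by linarith) (by linarith) hk hEj
  exact hinr j hkj (this.symm.trans (hall j hkj))

/-- If no collision takes place at the targets of levels above `k`, then no chunk `inr i` of such a
level meets any other chunk before time `2 * scale k`. -/
lemma alone_of_no_collision {k : ℕ} (hk : 2 * scale k ≤ T)
    (hN : ∀ j, k < j → Z (Sum.inl j) (2 * scale j) ≠ Z (Sum.inr j) (2 * scale j)) :
    ∀ i, k < i → ∀ r, 0 ≤ r → r < 2 * scale k → ∀ d, d ≠ Sum.inr i →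
      Z d r ≠ Z (Sum.inr i) r := by
  intro i
  induction i using Nat.strong_induction_on with
  | _ i IH =>
  intro hki
  have hsi := scale_pos i
  have hsk := scale_pos k
  have hεi := speed_pos i
  have hri := reach_pos i
  have hreach : reach i = speed i * scale i := rfl
  have hii := scale_le_isoTime hki
  have hkk := isoTime_le_scale k
  -- The case `l = k` comes from `alone_before` and needs no hypothesis on collisions.
  have hIH : ∀ l, k ≤ l → l < i → ∀ r, 0 ≤ r → r < 2 * scale k → ∀ d, d ≠ Sum.inr l →
      Z d r ≠ Z (Sum.inr l) r := fun l hkl hli => by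
    rcases hkl.eq_or_lt with rfl | hkl
    · exact h.alone_before hk
    · exact IH l hli hkl
  refine h.alone_of_gap fun τ hτ hτk H => ?_
  have hτT : τ ≤ T := hτk.le.trans hk
  rcases lt_or_ge τ (2 * scale i) with hτi | hτi
  · exact h.gap_before hτ hτi hτT H
  have hτ0 : 0 < τ := by linarith
  have hfree := h.eq_free_of_alone hτ0 hτT H
  have hfree' : ∀ r, 0 ≤ r → r < τ → Z (Sum.inr i) r = free y (Sum.inr i) r := fun r hr hrτ =>
    h.eq_free hr (by linarith) (H r hr hrτ)
  have hlow : ∀ d, level d < i → τ ≤ isoTime (level d) → d ≠ Sum.inr i →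
      isoTime i ≤ dist (Z d τ) (Z (Sum.inr i) τ) := fun d hd hτd hne => by
    have h1 := h.isolated d (Sum.inr i) τ hτ hτT hτd hne.symm
    have h2 := isoTime_le_scale i
    have h3 := scale_le_isoTime hd
    rw [dist_comm]; linarith
  rcases le_or_gt τ (4 * scale i) with hτi' | hτi'
  · -- shortly after crossing the axis
    -- At the crossing time this is the hypothesis `hN`. Afterwards the cluster of `inl i` has
    -- stayed on the axis by `inl_ne_inr`, while `inr i` is strictly below.
    have hne : Z (Sum.inl i) τ ≠ Z (Sum.inr i) τ := by
      rcases hτi.eq_or_lt with rfl | hτi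
      · exact hN i hki
      intro he
      have hpure := fun j (hj : i < j) => h.inl_ne_inr hτi' hτT (by linarith)
        (fun r hr hrτ => H r hr hrτ _ (by simp)) hj
      have hiso : isoTime i < τ := by linarith [isoTime_le_scale i]
      have h0 : (Z (Sum.inl i) τ).2 = 0 :=
        eq_of_forall_Ioo_eq (h := fun r => (Z (Sum.inl i) r).2) (h.continuous _).snd hiso
          fun r hr hrτ => by
            have hr0 : 0 ≤ r := by linarith [isoTime_pos i]
            have hz : ∀ d, Z d r = Z (Sum.inl i) r → (free y d r).2 = 0 := by
              intro d hd
              have hl : i ≤ level d :=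
                h.le_level (c := Sum.inl i) hr0 (by linarith) (by linarith) le_rfl hd
              rcases d with j | j
              · rfl
              · rcases (show i ≤ j from hl).eq_or_lt with rfl | hij
                · exact absurd hd.symm (H r hr0 hrτ _ (by simp))
                · exact absurd hd (hpure j hij r hr0 hrτ)
            exact le_antisymm (h.snd_le hr0 (by linarith) fun d hd => (hz d hd).le)
              (h.le_snd hr0 (by linarith) fun d hd => (hz d hd).ge)
      rw [he, hfree, free_inr_snd] at h0
      have := mul_neg_of_pos_of_neg hεi (show 2 * scale i - τ < 0 by linarith)
      linarith
    refine ⟨min (min (isoTime i) (reach i / 4)) (dist (Z (Sum.inl i) τ) (Z (Sum.inr i) τ)),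
      lt_min (lt_min (isoTime_pos i) (by linarith)) (dist_pos.2 hne), fun d hd => ?_⟩
    rcases lt_or_ge (level d) i with hl | hl
    · exact (min_le_left _ _).trans ((min_le_left _ _).trans
        (hlow d hl (by linarith [scale_le_isoTime hl]) hd))
    -- Either `d` is stuck to `inl i`, whose distance to `inr i` is positive, or the cluster of `d`
    -- has never contained `inl i`. Its members are then slow or aimed close to the origin, so it
    -- stays to the right of `-(reach i / 4)`, whereas `inr i` has abscissa at most `-(reach i /
    -- 2)`.
    by_cases hmeet : ∃ r, 0 ≤ r ∧ r < τ ∧ Z d r = Z (Sum.inl i) r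
    · obtain ⟨r, hr, hrτ, he⟩ := hmeet
      rw [h.sticky _ _ r τ hr hrτ.le hτT he]
      exact min_le_right _ _
    · push Not at hmeet
      refine (min_le_left _ _).trans ((min_le_right _ _).trans ?_)
      refine le_trans ?_ ((le_abs_self _).trans (fst_le_dist Z _ _ τ))
      refine le_of_forall_Ioo_le (h := fun r => (Z d r).1 - (Z (Sum.inr i) r).1)
        ((h.continuous _).fst.sub (h.continuous _).fst) hτ0 fun r hr hrτ => ?_
      rw [hfree' r hr.le hrτ, free_inr_fst]
      have hyi := h.target_le i
      have h1 : -(reach i / 4) ≤ (Z d r).1 := by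
        refine h.le_fst hr.le (by linarith) fun d' hd' => ?_
        have hl' : i ≤ level d' := h.le_level (c := d) hr.le (by linarith) (by linarith) hl hd'
        rcases d' with j | j
        · rcases (show i ≤ j from hl').eq_or_lt with rfl | hij
          · exact absurd hd'.symm (hmeet r hr.le hrτ)
          · have h2 := mul_le_mul (speed_le_of_lt hij) (show r ≤ 4 * scale i by linarith)
              hr.le (by positivity)
            have := reach_pos j
            rw [free_inl_fst]; linarith
        · rcases (show i ≤ j from hl').eq_or_lt with rfl | hij
          · exact absurd hd'.symm (H r hr.le hrτ d hd)
          · have := h.le_target j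
            have := reach_le_of_lt hij
            rw [free_inr_fst]; linarith
      linarith
  · -- long after crossing the axis
    have hδ : 0 < speed i * scale i / 2 := by positivity
    refine ⟨min (isoTime i) (speed i * scale i / 2), lt_min (isoTime_pos i) hδ, fun d hd => ?_⟩
    rcases lt_or_ge (level d) k with hl | hl
    · exact (min_le_left _ _).trans
        (hlow d (hl.trans hki) (by linarith [scale_le_isoTime hl]) hd)
    refine (min_le_right _ _).trans ?_
    -- A particle `inr l` with `k ≤ l < i` is alone by induction and separated horizontally, the
    -- targets being distinct. Any other cluster falls at most at speed `speed i / 100`, and so is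
    -- well above `inr i` by now.
    by_cases hdl : ∃ l, l < i ∧ d = Sum.inr l
    · obtain ⟨l, hli, rfl⟩ := hdl
      have hkl : k ≤ l := hl
      have h1 := (neg_le_abs _).trans (fst_le_dist Z (Sum.inr i) (Sum.inr l) τ)
      refine le_trans ?_ h1
      rw [h.eq_free hτ hτT (hIH l hkl hli τ hτ hτk), hfree, free_inr_fst, free_inr_fst]
      have := h.target_le l
      have := h.le_target i
      have := reach_le_of_lt hli
      have := reach_pos i
      linarith
    · refine le_trans ?_ ((le_abs_self _).trans (snd_le_dist Z _ _ τ))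
      refine le_of_forall_Ioo_le (h := fun r => (Z d r).2 - (Z (Sum.inr i) r).2)
        ((h.continuous _).snd.sub (h.continuous _).snd) hτi' fun r hr hrτ => ?_
      have hr0 : 0 ≤ r := by linarith
      rw [hfree' r hr0 hrτ, free_inr_snd]
      have h1 : -(speed i / 100 * r) ≤ (Z d r).2 := by
        refine h.le_snd hr0 (by linarith) fun d' hd' => ?_
        have hl' : k ≤ level d' := h.le_level (c := d) hr0 (by linarith) (by linarith) hl hd'
        rcases d' with j | j
        · rw [free_inl_snd, neg_nonpos]; positivity
        · rcases lt_trichotomy j i with hji | rfl | hij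
          · refine absurd hd'.symm (hIH j hl' hji r hr0 (by linarith) d fun e => hdl ⟨j, hji, e⟩)
          · exact absurd hd'.symm (H r hr0 hrτ d hd)
          · have h2 := mul_le_mul_of_nonneg_right (speed_le_of_lt hij) hr0
            have := mul_pos (speed_pos j) (scale_pos j)
            rw [free_inr_snd]; linarith
      have h3 : speed i * (4 * scale i) ≤ speed i * r := mul_le_mul_of_nonneg_left hr.le hεi.le
      have h4 : 0 < speed i * scale i := by positivity
      linarith

end IsStickySystem

/-! ### Absence of collisions forces a collision; the paradox -/

namespace IsStickySystem

variable {T : ℝ} {m : ℕ ⊕ ℕ → ℝ} {y : ℕ → ℝ} {Z : ℕ ⊕ ℕ → ℝ → ℝ × ℝ}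
  (h : IsStickySystem T m y Z)
include h

/-- After `inl k` has overtaken all chunks of higher level, its position is dominated by its own
free motion. -/
lemma inl_fst_le {k : ℕ} {r : ℝ} (hr : 7 / 4 * scale k ≤ r) (hrk : r ≤ 4 * scale k) (hrT : r ≤ T) :
    (Z (Sum.inl k) r).1 ≤ -(reach k / 2) := by
  classical
  have hs := scale_pos k
  have hr0 : 0 ≤ r := by linarith
  have hk := reach_pos k
  refine center_le_of_moment h.mass.summable h.mass.pos (S := {d | Z d r = Z (Sum.inl k) r})
    (c := Sum.inl k) rfl (fun d => h.abs_free_fst_le d hr0)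
    (by convert h.center_fst (Sum.inl k) r hr0 hrT) ?_
  refine tsum_nonpos_of_dominant (c := Sum.inl k)
    (u := fun d => (if d ∈ {d | k ≤ level d ∧ d ≠ Sum.inl k} then m d else 0) * reach k)
    (summable_center h.mass.summable h.mass.pos _ (fun d => h.abs_free_fst_le d hr0) _)
    ((h.mass.summable_ite _).mul_right _) (fun d hd => ?_) (by simp) ?_
  · have hmd := h.mass.pos d
    by_cases hS : Z d r = Z (Sum.inl k) r
    · have hl : k ≤ level d := h.le_level (c := Sum.inl k) hr0 hrT hrk le_rfl hS
      simp only [mem_ofPred_eq, hS, hl, hd, if_true, ne_eq, not_false_eq_true, and_self]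
      refine mul_le_mul_of_nonneg_left ?_ hmd.le
      rcases d with j | j
      · have hkj : k < j := lt_of_le_of_ne hl fun e => hd (by rw [e])
        have := reach_le_of_lt hkj
        have := mul_nonneg (speed_pos j).le hr0
        rw [free_inl_fst]; linarith
      · have := h.target_le j
        have := reach_pos j
        rw [free_inr_fst]; linarith
    · simp only [mem_ofPred_eq, hS, if_false]
      split_ifs
      · positivity
      · simp
  · rw [tsum_mul_right, if_pos (show Sum.inl k ∈ {d | Z d r = Z (Sum.inl k) r} from rfl),
      free_inl_fst]
    have htail := mul_le_mul_of_nonneg_right (h.mass.tail_level k) hk.le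
    have hmk := h.mass.pos (Sum.inl k)
    have h1 : speed k * (7 / 4 * scale k) ≤ speed k * r :=
      mul_le_mul_of_nonneg_left hr (speed_pos k).le
    have h2 : reach k = speed k * scale k := rfl
    have h3 : m (Sum.inl k) * (reach k - speed k * r - -(reach k / 2)) ≤
        m (Sum.inl k) * (-(reach k / 4)) := mul_le_mul_of_nonneg_left (by linarith) hmk.le
    have h4 := mul_pos hmk hk
    linarith

/-- If no collision takes place at the targets of levels above `k`, then one takes place at the
target of level `k`. -/
lemma collision {k : ℕ} (hk : 2 * scale k ≤ T)
    (hN : ∀ j, k < j → Z (Sum.inl j) (2 * scale j) ≠ Z (Sum.inr j) (2 * scale j)) :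
    Z (Sum.inl k) (2 * scale k) = Z (Sum.inr k) (2 * scale k) := by
  classical
  have hs := scale_pos k
  have hx := reach_pos k
  have hε := speed_pos k
  have hxs : reach k = speed k * scale k := rfl
  have hσ := isoTime_pos k
  have hσs := isoTime_le_scale k
  have halone : ∀ i, k ≤ i → ∀ r, 0 ≤ r → r < 2 * scale k → ∀ d, d ≠ Sum.inr i →
      Z d r ≠ Z (Sum.inr i) r := fun i hki => by
    rcases hki.eq_or_lt with rfl | hki
    · exact h.alone_before hk
    · exact h.alone_of_no_collision hk hN i hki
  have hpure : ∀ {i r d}, k ≤ i → 0 ≤ r → r < 2 * scale k → Z d r = Z (Sum.inl i) r →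
      ∃ j, k ≤ j ∧ d = Sum.inl j := by
    intro i r d hki hr hrk hd
    have hl : k ≤ level d :=
      h.le_level (c := Sum.inl i) hr (hrk.le.trans hk) (by linarith) hki hd
    rcases d with j | j
    · exact ⟨j, hl, rfl⟩
    · exact absurd hd.symm (halone j hl r hr hrk _ (by simp))
  have hsnd : ∀ i, k ≤ i → ∀ r, 0 ≤ r → r < 2 * scale k → (Z (Sum.inl i) r).2 = 0 := by
    intro i hki r hr hrk
    have hz : ∀ d, Z d r = Z (Sum.inl i) r → (free y d r).2 = 0 := by
      intro d hd
      obtain ⟨j, -, rfl⟩ := hpure hki hr hrk hd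
      rfl
    exact le_antisymm (h.snd_le hr (by linarith) fun d hd => (hz d hd).le)
      (h.le_snd hr (by linarith) fun d hd => (hz d hd).ge)
  -- The time `7 / 4 * scale k` is late enough for `inl k` to have overtaken the others, and still
  -- before `2 * scale k`, up to which all clusters involved lie on the axis. There a change of
  -- horizontal order means a meeting, by the intermediate value theorem.
  have hmeet : ∀ j, k < j → Z (Sum.inl j) (7 / 4 * scale k) = Z (Sum.inl k) (7 / 4 * scale k) := by
    intro j hkj
    by_contra hne
    set r := 7 / 4 * scale k with hr
    have hr0 : 0 ≤ r := by linarith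
    have hright : -(reach k / 4) ≤ (Z (Sum.inl j) r).1 := by
      refine h.le_fst hr0 (by linarith) fun d hd => ?_
      obtain ⟨i, hki, rfl⟩ := hpure hkj.le hr0 (by linarith) hd
      have hki' : k < i := lt_of_le_of_ne hki (by rintro rfl; exact hne hd.symm)
      have h1 := mul_le_mul_of_nonneg_right (speed_le_of_lt hki') hr0
      have h2 : speed k / 100 * r = 7 / 400 * reach k := by rw [hr, hxs]; ring
      have := reach_pos i
      rw [free_inl_fst]; linarith
    have hleft := h.inl_fst_le (k := k) (r := r) le_rfl (by linarith) (by linarith)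
    have hleft' : (Z (Sum.inl j) (isoTime k)).1 ≤ reach k / 4 := by
      refine h.fst_le hσ.le (by linarith) fun d hd => ?_
      obtain ⟨i, hki, rfl⟩ := hpure hkj.le hσ.le (by linarith) hd
      have hki' : k < i := lt_of_le_of_ne hki (by
        rintro rfl
        exact h.ne_of_le_isoTime (c := Sum.inl k) hσ.le (by linarith) le_rfl
          (by simpa using hkj.ne') hd.symm)
      have := mul_nonneg (speed_pos i).le hσ.le
      have := reach_le_of_lt hki'
      rw [free_inl_fst]; linarith
    have hright' : reach k / 2 ≤ (Z (Sum.inl k) (isoTime k)).1 := by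
      rw [h.eq_free hσ.le (by linarith) fun d hd =>
        h.ne_of_le_isoTime (c := Sum.inl k) hσ.le (by linarith) le_rfl hd, free_inl_fst]
      have := mul_le_mul_of_nonneg_left hσs hε.le
      linarith
    obtain ⟨r₁, hr₁, he⟩ := intermediate_value_Icc (a := isoTime k) (b := r) (by linarith)
      (f := fun r => (Z (Sum.inl j) r).1 - (Z (Sum.inl k) r).1)
      ((h.continuous _).fst.sub (h.continuous _).fst).continuousOn
      (show (0 : ℝ) ∈ Icc _ _ from ⟨by linarith, by linarith⟩)
    have hr₁0 : 0 ≤ r₁ := hσ.le.trans hr₁.1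
    refine hne (h.sticky _ _ r₁ r hr₁0 hr₁.2 (by linarith) (Prod.ext (sub_eq_zero.1 he) ?_))
    rw [hsnd j hkj.le r₁ hr₁0 (by linarith [hr₁.2]), hsnd k le_rfl r₁ hr₁0 (by linarith [hr₁.2])]
  set t := 2 * scale k with ht
  have ht0 : 0 ≤ t := by linarith
  have hall : ∀ j, k ≤ j → Z (Sum.inl j) t = Z (Sum.inl k) t := by
    intro j hkj
    rcases hkj.eq_or_lt with rfl | hkj
    · rfl
    · exact h.sticky _ _ _ t (by linarith) (by linarith) hk (hmeet j hkj)
  have h0 : (Z (Sum.inl k) t).2 = 0 :=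
    eq_of_forall_Ioo_eq (h := fun r => (Z (Sum.inl k) r).2) (h.continuous _).snd
      (show 0 < t by linarith) fun r hr hrt => hsnd k le_rfl r hr.le hrt
  by_contra hne
  have hlev : ∀ {d}, Z d t = Z (Sum.inl k) t → k ≤ level d := fun hd =>
    h.le_level (c := Sum.inl k) ht0 hk (by linarith) le_rfl hd
  -- The preceding purity holds only strictly before `t`. At `t` itself the cluster has height `0`
  -- by continuity, which excludes members strictly below the axis, since none is above it.
  have hinr : ∀ j, Z (Sum.inr j) t ≠ Z (Sum.inl k) t := by
    intro j hj
    have hkj : k < j := lt_of_le_of_ne (hlev hj) (by rintro rfl; exact hne hj.symm)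
    refine (tsum_lt_zero_of_nonpos (c := Sum.inr j) (summable_center h.mass.summable h.mass.pos
      {d | Z d t = Z (Sum.inl k) t} (fun d => abs_free_snd_le y d ht0) (Z (Sum.inl k) t).2)
      (fun d => ?_) ?_).ne (by convert h.center_snd (Sum.inl k) t ht0 hk)
    · split_ifs with hd
      · refine mul_nonpos_of_nonneg_of_nonpos (h.mass.pos d).le ?_
        rw [h0, sub_zero]
        exact free_snd_nonpos y (k := k) (by linarith) (hlev hd) (Or.inr le_rfl)
      · rfl
    · rw [if_pos (show Sum.inr j ∈ {d | Z d t = Z (Sum.inl k) t} from hj), h0, free_inr_snd,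
        sub_zero]
      have := scale_le_isoTime hkj
      have := scale_pos j
      exact mul_neg_of_pos_of_neg (h.mass.pos _)
        (mul_neg_of_pos_of_neg (speed_pos j) (by linarith))
  have hp : ∀ j, 0 < m (Sum.inl j) := fun j => h.mass.pos _
  have hsm : Summable fun j => m (Sum.inl j) := h.mass.summable.comp_injective Sum.inl_injective
  have hB : ∀ j, |(free y (Sum.inl j) t).1| ≤ 1 + t := fun j => h.abs_free_fst_le _ ht0
  obtain ⟨U, hU⟩ : ∃ U : Set ℕ, ∀ j, j ∈ U ↔ k ≤ j := ⟨_, fun _ => Iff.rfl⟩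
  have hkU : k ∈ U := (hU k).2 le_rfl
  have h1 : ∑' j, (if j ∈ U then
      m (Sum.inl j) * ((free y (Sum.inl j) t).1 - (Z (Sum.inl k) t).1) else 0) = 0 := by
    refine Eq.trans ?_ ((Sum.inl_injective.tsum_eq (f := fun d =>
      if d ∈ {d | Z d t = Z (Sum.inl k) t} then
        m d * ((free y d t).1 - (Z (Sum.inl k) t).1) else 0) ?_).trans
          (by convert h.center_fst (Sum.inl k) t ht0 hk))
    · refine tsum_congr fun j => ?_
      by_cases hj : k ≤ j
      · simp only [hU, hj, hall j hj, mem_ofPred_eq, if_true]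
      · have : Z (Sum.inl j) t ≠ Z (Sum.inl k) t := fun he => hj (hlev he)
        simp only [hU, hj, this, mem_ofPred_eq, if_false]
    · intro d hd
      rcases d with j | j
      · exact ⟨j, rfl⟩
      · refine absurd ?_ hd
        simp [hinr j]
  have h2 : ∑' j, (if j ∈ U then
      m (Sum.inl j) * ((free y (Sum.inl j) t).1 - y k) else 0) = 0 := by
    simpa [hU] using h.target k
  refine hne ((Prod.ext ?_ h0).trans (h.inr_eq_target hk).symm)
  exact le_antisymm (center_le_of_moment hsm hp hkU hB h1 h2.le)
    (le_center_of_moment hsm hp hkU hB h1 h2.ge)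

/-- Yablo's paradox: sticky systems do not exist on any time interval. -/
theorem false_of_pos (hT : 0 < T) : False := by
  obtain ⟨K, hK⟩ := exists_scale_lt (show 0 < T / 2 by linarith)
  have hKT : ∀ k, K ≤ k → 2 * scale k ≤ T := fun k hk => by linarith [scale_anti hk]
  -- A collision at `k` forbids all at higher levels, and the absence of those above `k + 1` forces
  -- one at `k + 1`. With no collision at all from `K` on, one is forced at `K`.
  by_cases hE : ∃ k, K ≤ k ∧ Z (Sum.inl k) (2 * scale k) = Z (Sum.inr k) (2 * scale k)
  · obtain ⟨k, hk, hE⟩ := hE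
    have hN := fun j (hj : k < j) => h.ne_of_collision (hKT k hk) hE hj
    exact hN (k + 1) k.lt_succ_self (h.collision (hKT _ (hk.trans k.le_succ))
      fun j hj => hN j (k.lt_succ_self.trans hj))
  · push Not at hE
    exact hE K le_rfl (h.collision (hKT K le_rfl) fun j hj => hE j hj.le)

end IsStickySystem

/-! ### Measurability -/

/-- A Borel function which is constant on the fibers of another Borel function, outside of a null
set, factors through it almost everywhere. -/
lemma exists_measurable_factor {Ω E F : Type*} [MeasurableSpace Ω] [StandardBorelSpace Ω]
    [MeasurableSpace E] [StandardBorelSpace E] [MeasurableSpace F] [StandardBorelSpace F]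
    [Nonempty F] {μ : Measure Ω} {f : Ω → E} {g : Ω → F} (hf : Measurable f) (hg : Measurable g)
    {G : Set Ω} (hG : ∀ᵐ y ∂μ, y ∈ G) (H : ∀ y₁ ∈ G, ∀ y₂ ∈ G, f y₁ = f y₂ → g y₁ = g y₂) :
    ∃ h : E → F, Measurable h ∧ ∀ᵐ y ∂μ, g y = h (f y) := by
  obtain ⟨G', hG', hm, hsub⟩ := hG.exists_measurable_mem
  have := hm.standardBorel
  let f' : G' → E := fun y => f y
  let g' : G' → F := fun y => g y
  have hf' : Measurable f' := hf.comp measurable_subtype_coe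
  have hg' : Measurable g' := hg.comp measurable_subtype_coe
  obtain ⟨w, hw⟩ := (Function.factorsThrough_iff g').1 fun y₁ y₂ h =>
    H y₁ (hsub _ y₁.2) y₂ (hsub _ y₂.2) h
  -- The factor `w` is merely a function. Its measurability on the range of `f'` is the descriptive
  -- set theoretic point: it rests on the separation of disjoint analytic sets.
  have hw' := (hf'.measurable_comp_iff_restrict (g := w)).1 (hw ▸ hg')
  have hcomap : Measurable[MeasurableSpace.comap f' inferInstance] g' := by
    intro B hB
    obtain ⟨S, hS, hSB⟩ := hw' hB
    refine ⟨S, hS, ?_⟩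
    ext y
    have := Set.ext_iff.1 hSB ⟨f' y, mem_range_self y⟩
    rw [hw]
    exact this
  obtain ⟨h, hh, hgh⟩ := hcomap.exists_eq_measurable_comp
  refine ⟨h, hh, ?_⟩
  filter_upwards [hG'] with y hy
  exact congrFun hgh ⟨y, hy⟩

lemma integrable_inner_of_bound {Ω E : Type*} [MeasurableSpace Ω] {μ : Measure Ω}
    [NormedAddCommGroup E] [InnerProductSpace ℝ E] {f g : Ω → E} (hf : Integrable f μ)
    (hg : AEStronglyMeasurable g μ) {C : ℝ} (hC : ∀ y, ‖g y‖ ≤ C) :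
    Integrable (fun y => ⟪f y, g y⟫) μ := by
  refine (hf.norm.mul_const C).mono' (hf.1.inner hg) (ae_of_all _ fun y => ?_)
  exact (norm_inner_le_norm _ _).trans (mul_le_mul_of_nonneg_left (hC y) (norm_nonneg _))

variable {n : ℕ}

/-- Bounded Borel functions belong to `J(X, t)`. -/
lemma mem_sectionJ_of_bound {F : Type*} [NormedAddCommGroup F] [NormedSpace ℝ F]
    [MeasurableSpace F] [BorelSpace F] [SecondCountableTopology F] {D : Set (Space n)}
    [IsFiniteMeasure (labels D)] {X : ℝ → Space n → Space n} {t : ℝ}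
    (hX : AEMeasurable (X t) (labels D)) {φ : Space n → F} (hφ : Measurable φ) {C : ℝ}
    (hC : ∀ x, ‖φ x‖ ≤ C) : φ ∈ sectionJ F D X t := by
  refine ⟨hφ, fun ε hε => ?_⟩
  have hmem : MemLp φ 2 ((labels D).map (X t)) :=
    MemLp.of_bound hφ.aestronglyMeasurable C (ae_of_all _ hC)
  obtain ⟨δ, hδ, hδε⟩ : ∃ δ : ℝ, 0 < δ ∧ ENNReal.ofReal δ < ε := by
    obtain ⟨δ, hδ, hδε⟩ := ENNReal.lt_iff_exists_nnreal_btwn.1 hε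
    exact ⟨δ, by simpa using hδ, by simpa using hδε⟩
  obtain ⟨g, hg, hg', hle⟩ := hmem.exist_eLpNorm_sub_le (by simp) (by norm_num) hδ
  refine ⟨g, hg'.of_le (by norm_cast), hg, lt_of_le_of_lt ?_ hδε⟩
  rwa [eLpNorm_map_measure (hφ.aestronglyMeasurable.sub hg'.continuous.aestronglyMeasurable)
    hX] at hle

/-- A flow coincides, for almost every label, with a Borel flow with continuous trajectories. -/
lemma IsFlow.exists_regular {T : ℝ} (hT : 0 ≤ T) {D : Set (Space n)}
    {X : ℝ → Space n → Space n} (h : IsFlow T D X) :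
    ∃ Y : ℝ → Space n → Space n, (∀ t, Measurable (Y t)) ∧ (∀ y, Continuous fun t => Y t y) ∧
      ∀ᵐ y ∂(labels D), ∀ t ∈ Icc 0 T, Y t y = X t y := by
  let c : ℝ → ℝ := fun t => max 0 (min t T)
  have hc : Continuous c := by fun_prop
  have hcm : ∀ t, c t ∈ Icc 0 T := fun t => ⟨le_max_left _ _, max_le hT (min_le_right _ _)⟩
  have hc' : ∀ t ∈ Icc 0 T, c t = t := fun t ht => by
    simp only [c]; rw [min_eq_left ht.2, max_eq_right ht.1]
  have hgood : ∀ᵐ y ∂(labels D), ContinuousOn (fun t => X t y) (Icc 0 T) ∧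
      ∀ q : ℚ, X (c q) y = (h.measurable (c q) (hcm q)).mk _ y :=
    h.continuous.and (ae_all_iff.2 fun q => (h.measurable (c q) (hcm q)).ae_eq_mk)
  obtain ⟨G, hG, hGm, hsub⟩ := hgood.exists_measurable_mem
  have hcont : ∀ y, Continuous fun t => G.indicator (X (c t)) y := by
    intro y
    by_cases hy : y ∈ G
    · simp only [indicator_of_mem hy]
      exact (hsub y hy).1.comp_continuous hc hcm
    · simp only [indicator_of_notMem hy]
      exact continuous_const
  have hrat : ∀ q : ℚ, Measurable (G.indicator (X (c q))) := by
    intro q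
    have : G.indicator (X (c q)) = G.indicator ((h.measurable (c q) (hcm q)).mk _) := by
      ext1 y
      by_cases hy : y ∈ G
      · simp only [indicator_of_mem hy, (hsub y hy).2 q]
      · simp only [indicator_of_notMem hy]
    rw [this]
    exact (h.measurable (c q) (hcm q)).measurable_mk.indicator hGm
  refine ⟨fun t => G.indicator (X (c t)), fun t => ?_, hcont, ?_⟩
  -- A single null set can be removed only for countably many times; continuity of the paths carries
  -- measurability from rational to real times.
  · obtain ⟨q, -, -, hq⟩ := Real.exists_seq_rat_strictMono_tendsto t
    refine measurable_of_tendsto_metrizable (fun k => hrat (q k)) (tendsto_pi_nhds.2 fun y => ?_)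
    exact ((hcont y).tendsto t).comp hq
  · filter_upwards [hG] with y hy t ht
    simp only [indicator_of_mem hy, hc' t ht]

lemma IsFlow.memLp_forwardDeriv {T : ℝ} (hT : 0 < T) {D : Set (Space n)}
    {X : ℝ → Space n → Space n} (h : IsFlow T D X) : MemLp (forwardDeriv X 0) 2 (labels D) := by
  refine ⟨?_, ?_⟩
  · have hmem : ∀ k : ℕ, T / (k + 1) ∈ Icc 0 T := fun k =>
      ⟨by positivity, div_le_self hT.le (by linarith [(k.cast_nonneg : (0 : ℝ) ≤ k)])⟩
    refine aestronglyMeasurable_of_tendsto_ae (u := atTop)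
      (f := fun (k : ℕ) y => (T / (k + 1))⁻¹ • (X (T / (k + 1)) y - X 0 y)) (fun k => ?_) ?_
    · exact ((h.measurable _ (hmem k)).sub
        (h.measurable 0 ⟨le_rfl, hT.le⟩)).aestronglyMeasurable.const_smul (T / ((k : ℝ) + 1))⁻¹
    · filter_upwards [h.differentiable] with y hy
      have h1 := (hy 0 ⟨le_rfl, hT⟩).hasDerivWithinAt.Ioi_of_Ici
      rw [hasDerivWithinAt_iff_tendsto_slope' (by simp)] at h1
      have h2 : Tendsto (fun k : ℕ => T / ((k : ℝ) + 1)) atTop (𝓝[>] 0) := by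
        refine tendsto_nhdsWithin_iff.2 ⟨?_, Eventually.of_forall fun k => ?_⟩
        · have := (tendsto_one_div_add_atTop_nhds_zero_nat (𝕜 := ℝ)).const_mul T
          simpa [div_eq_mul_inv] using this
        · simp only [mem_Ioi]; positivity
      simpa [slope_def_module, Function.comp_def, forwardDeriv] using h1.comp h2
  · obtain ⟨C, hC, hE⟩ := h.energy
    rw [eLpNorm_lt_top_iff_lintegral_rpow_enorm_lt_top (by simp) (by simp)]
    simpa using (hE 0 ⟨le_rfl, hT⟩).trans_lt hC

variable {n : ℕ}

/-- A Borel representative `Y` of a sticky weak solution. -/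
structure IsRegular (T : ℝ) (D : Set (Space n)) (X Y : ℝ → Space n → Space n) : Prop where
  pos : 0 < T
  finite : IsFiniteMeasure (labels D)
  mem : ∀ᵐ y ∂(labels D), y ∈ D
  measurable : ∀ t, Measurable (Y t)
  continuous : ∀ y, Continuous fun t => Y t y
  ae_eq : ∀ᵐ y ∂(labels D), ∀ t ∈ Icc 0 T, Y t y = X t y

/-! ### The velocity as a conditional expectation of the initial velocity -/

namespace IsRegular

variable {T : ℝ} {D : Set (Space n)} {X Y : ℝ → Space n → Space n} (hY : IsRegular T D X Y)
include hY

lemma ae_eq_at {t : ℝ} (ht : t ∈ Icc 0 T) : ∀ᵐ y ∂(labels D), Y t y = X t y :=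
  hY.ae_eq.mono fun _ h => h t ht

lemma measurable_uncurry : Measurable (Function.uncurry Y) :=
  measurable_uncurry_of_continuous_of_measurable hY.continuous hY.measurable

variable {ρ : Measure (Space n)} [IsFiniteMeasure ρ] {v₀ : Space n → Space n}
  (h : IsStickyWeakSolution ρ v₀ T D X)
include h

lemma map_zero : (labels D).map (Y 0) = ρ := by
  have := hY.finite
  have h0 : (0 : ℝ) ∈ Icc 0 T := ⟨le_rfl, hY.pos.le⟩
  refine Measure.ext fun S hS => ?_
  have h1 := h.initial_density (S.indicator fun _ => (1 : ℝ))
    (mem_sectionJ_of_bound (h.flow.measurable 0 h0) (measurable_const.indicator hS) (C := 1)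
      fun x => by
        by_cases hx : x ∈ S <;> simp [hx])
  rw [integral_indicator hS] at h1
  have h2 : ∫ y, S.indicator (fun _ => (1 : ℝ)) (X 0 y) ∂(labels D) =
      ∫ y, S.indicator (fun _ => (1 : ℝ)) (Y 0 y) ∂(labels D) :=
    integral_congr_ae ((hY.ae_eq_at h0).mono fun y hy => by simp only [hy])
  rw [h2] at h1
  have h3 : (fun y => S.indicator (fun _ => (1 : ℝ)) (Y 0 y)) =
      (Y 0 ⁻¹' S).indicator fun _ => (1 : ℝ) := rfl
  rw [h3, integral_indicator (hY.measurable 0 hS)] at h1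
  simp only [integral_const, smul_eq_mul, mul_one, measureReal_restrict_apply_univ] at h1
  rw [Measure.map_apply (hY.measurable 0) hS]
  exact (measureReal_eq_measureReal_iff).1 h1

-- Stickiness in functional form: the later position is a Borel function of the earlier one, so test
-- functions of `Y t` are also test functions of `Y s`.
omit [IsFiniteMeasure ρ] in
lemma exists_factor {s t : ℝ} (hs : 0 ≤ s) (hst : s ≤ t) (ht : t ≤ T) :
    ∃ f : Space n → Space n, Measurable f ∧ ∀ᵐ y ∂(labels D), Y t y = f (Y s y) := by
  refine exists_measurable_factor (hY.measurable s) (hY.measurable t)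
    (G := {y | y ∈ D ∧ ∀ t ∈ Icc 0 T, Y t y = X t y}) (hY.mem.and hY.ae_eq) ?_
  intro y₁ hy₁ y₂ hy₂ he
  have hs' : s ∈ Icc 0 T := ⟨hs, hst.trans ht⟩
  have ht' : t ∈ Icc 0 T := ⟨hs.trans hst, ht⟩
  rw [hy₁.2 s hs', hy₂.2 s hs'] at he
  rw [hy₁.2 t ht', hy₂.2 t ht']
  exact h.sticky y₁ hy₁.1 y₂ hy₂.1 s hs' he t ⟨hst, ht⟩

variable (hv : Continuous v₀) (hv1 : ∀ x, ‖v₀ x‖ ≤ 1)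
include hv hv1

/-- Momentum is the projection of the initial momentum. -/
lemma integral_inner_initial {t : ℝ} (ht : t ∈ Icc 0 T) {φ : Space n → Space n}
    (hφ : Measurable φ) {C : ℝ} (hC : ∀ x, ‖φ x‖ ≤ C) :
    ∫ y, ⟪forwardDeriv X 0 y, φ (Y t y)⟫ ∂(labels D) =
      ∫ y, ⟪v₀ (Y 0 y), φ (Y t y)⟫ ∂(labels D) := by
  have := hY.finite
  have h0 : (0 : ℝ) ∈ Icc 0 T := ⟨le_rfl, hY.pos.le⟩
  obtain ⟨f, hf, hYf⟩ := hY.exists_factor h le_rfl ht.1 ht.2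
  have hV : Integrable (forwardDeriv X 0) (labels D) :=
    (h.flow.memLp_forwardDeriv hY.pos).integrable (by norm_num)
  have hv₀ : Integrable (fun y => v₀ (Y 0 y)) (labels D) :=
    Integrable.of_bound (hv.measurable.comp (hY.measurable 0)).aestronglyMeasurable 1
      (ae_of_all _ fun y => hv1 _)
  have hcomp : ∀ i : Fin n, Measurable fun x => φ (f x) i := fun i =>
    ((EuclideanSpace.proj (𝕜 := ℝ) i).continuous.measurable).comp (hφ.comp hf)
  have hcompC : ∀ (i : Fin n) x, ‖φ (f x) i‖ ≤ C := fun i x =>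
    (PiLp.norm_apply_le (φ (f x)) i).trans (hC _)
  -- The initial momentum is prescribed only against scalar functions of the initial position.
  -- Writing `φ (Y t y)` as `φ (f (Y 0 y))` makes its components admissible.
  have hmom : ∀ i : Fin n, ∫ y, φ (f (Y 0 y)) i • forwardDeriv X 0 y ∂(labels D) =
      ∫ y, φ (f (Y 0 y)) i • v₀ (Y 0 y) ∂(labels D) := by
    intro i
    have h1 := h.initial_momentum (fun x => φ (f x) i)
      (mem_sectionJ_of_bound (h.flow.measurable 0 h0) (hcomp i) (hcompC i))
    have h2 : ∫ y, φ (f (X 0 y)) i • forwardDeriv X 0 y ∂(labels D) =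
        ∫ y, φ (f (Y 0 y)) i • forwardDeriv X 0 y ∂(labels D) :=
      integral_congr_ae ((hY.ae_eq_at h0).mono fun y hy => by simp only [hy])
    rw [← h2, h1, ← hY.map_zero h, integral_map (hY.measurable 0).aemeasurable]
    exact ((hcomp i).aestronglyMeasurable.smul hv.aestronglyMeasurable)
  have hred : ∀ (g : Space n → Space n), Integrable g (labels D) →
      ∫ y, ⟪g y, φ (Y t y)⟫ ∂(labels D) =
        ∑ i, (∫ y, φ (f (Y 0 y)) i • g y ∂(labels D)) i := by
    intro g hg
    have hint : ∀ i : Fin n, Integrable (fun y => φ (f (Y 0 y)) i • g y) (labels D) := fun i =>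
      hg.bdd_smul C ((hcomp i).comp (hY.measurable 0)).aestronglyMeasurable
        (ae_of_all _ fun y => hcompC i _)
    have h1 : ∀ i : Fin n, (∫ y, φ (f (Y 0 y)) i • g y ∂(labels D)) i =
        ∫ y, φ (f (Y 0 y)) i * g y i ∂(labels D) := fun i =>
      ((EuclideanSpace.proj (𝕜 := ℝ) i).integral_comp_comm (hint i)).symm
    simp_rw [h1]
    have hI : ∀ i : Fin n, Integrable (fun y => φ (f (Y 0 y)) i * g y i) (labels D) := fun i =>
      (EuclideanSpace.proj (𝕜 := ℝ) i).integrable_comp (hint i)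
    rw [← integral_finsetSum _ fun i _ => hI i]
    refine integral_congr_ae (hYf.mono fun y hy => ?_)
    simp only [hy, PiLp.inner_apply]
    exact Finset.sum_congr rfl fun i _ => by simp
  rw [hred _ hV, hred _ hv₀]
  simp_rw [hmom]

/-- The velocity of a sticky weak solution is the projection of the initial velocity. -/
lemma integral_inner_velocity {v : ℝ → Space n → Space n} (hW : IsW T D X (forwardDeriv X 0) v)
    {t : ℝ} (ht : t ∈ Icc 0 T) {φ : Space n → Space n} (hφ : Measurable φ) {C : ℝ}
    (hC : ∀ x, ‖φ x‖ ≤ C) :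
    Integrable (fun y => v t (Y t y)) (labels D) ∧ ∫ y, ⟪v t (Y t y), φ (Y t y)⟫ ∂(labels D) =
      ∫ y, ⟪v₀ (Y 0 y), φ (Y t y)⟫ ∂(labels D) := by
  have := hY.finite
  have hV := h.flow.memLp_forwardDeriv hY.pos
  have hae := hY.ae_eq_at ht
  have hvm : Measurable fun y => v t (Y t y) := (hW.mem_section t ht).1.comp (hY.measurable t)
  have hvL : MemLp (fun y => v t (Y t y)) 2 (labels D) := by
    refine ⟨hvm.aestronglyMeasurable, ?_⟩
    rw [eLpNorm_congr_ae (g := fun y => v t (X t y)) (hae.mono fun y hy => by simp only [hy])]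
    exact (hW.norm_le t ht).trans_lt hV.2
  have hvI := hvL.integrable (by norm_num)
  refine ⟨hvI, ?_⟩
  rw [← hY.integral_inner_initial h hv hv1 ht hφ hC]
  have h1 := hW.orthogonal t ht (φ ∘ X t)
    ⟨φ, mem_sectionJ_of_bound (h.flow.measurable t ht) hφ hC, rfl⟩
  have h2 : ∫ y, ⟪v t (X t y) - forwardDeriv X 0 y, (φ ∘ X t) y⟫ ∂(labels D) =
      ∫ y, (⟪v t (Y t y), φ (Y t y)⟫ - ⟪forwardDeriv X 0 y, φ (Y t y)⟫) ∂(labels D) :=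
    integral_congr_ae (hae.mono fun y hy => by simp only [hy, inner_sub_left, Function.comp])
  have hφm : AEStronglyMeasurable (fun y => φ (Y t y)) (labels D) :=
    (hφ.comp (hY.measurable t)).aestronglyMeasurable
  rw [h2, integral_sub (integrable_inner_of_bound hvI hφm fun y => hC _)
    (integrable_inner_of_bound (hV.integrable (by norm_num)) hφm fun y => hC _)] at h1
  linarith

/-- Conditional expectation does not increase the sup norm: testing with the unit vector along `v`
on the set where `‖v‖ > 1` bounds the integral of `‖v‖` there by the measure of that set. -/
lemma norm_velocity_le {v : ℝ → Space n → Space n} (hW : IsW T D X (forwardDeriv X 0) v)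
    {t : ℝ} (ht : t ∈ Icc 0 T) : ∀ᵐ y ∂(labels D), ‖v t (Y t y)‖ ≤ 1 := by
  classical
  have := hY.finite
  have hvt : Measurable (v t) := (hW.mem_section t ht).1
  let S : Set (Space n) := {x | 1 < ‖v t x‖}
  have hS : MeasurableSet S := measurableSet_lt measurable_const hvt.norm
  let φ : Space n → Space n := S.indicator fun x => ‖v t x‖⁻¹ • v t x
  have hφ : Measurable φ := (hvt.norm.inv.smul hvt).indicator hS
  have hC : ∀ x, ‖φ x‖ ≤ 1 := by
    intro x
    by_cases hx : x ∈ S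
    · have : (1 : ℝ) < ‖v t x‖ := hx
      simp only [φ, indicator_of_mem hx, norm_smul, norm_inv, norm_norm]
      rw [inv_mul_cancel₀ (by linarith)]
    · simp [φ, indicator_of_notMem hx]
  obtain ⟨hvI, hint⟩ := hY.integral_inner_velocity h hv hv1 hW ht hφ hC
  have hφm : AEStronglyMeasurable (fun y => φ (Y t y)) (labels D) :=
    (hφ.comp (hY.measurable t)).aestronglyMeasurable
  have hv₀ : Integrable (fun y => v₀ (Y 0 y)) (labels D) :=
    Integrable.of_bound (hv.measurable.comp (hY.measurable 0)).aestronglyMeasurable 1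
      (ae_of_all _ fun y => hv1 _)
  have hI1 := integrable_inner_of_bound hvI hφm fun y => hC _
  have hI2 := integrable_inner_of_bound hv₀ hφm fun y => hC _
  have hval : ∀ x ∈ S, ⟪v t x, φ x⟫ = ‖v t x‖ := by
    intro x hx
    have : (1 : ℝ) < ‖v t x‖ := hx
    simp only [φ, indicator_of_mem hx, inner_smul_right, real_inner_self_eq_norm_sq]
    field_simp
  have hle : ∀ y, ⟪v₀ (Y 0 y), φ (Y t y)⟫ ≤ 1 := fun y =>
    (real_inner_le_norm _ _).trans (mul_le_one₀ (hv1 _) (norm_nonneg _) (hC _))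
  have hnn : 0 ≤ fun y => ⟪v t (Y t y), φ (Y t y)⟫ - ⟪v₀ (Y 0 y), φ (Y t y)⟫ := by
    intro y
    by_cases hy : Y t y ∈ S
    · have h1 : (1 : ℝ) < ‖v t (Y t y)‖ := hy
      have h2 := hle y
      simp only [Pi.zero_apply, hval _ hy]
      linarith
    · simp [φ, indicator_of_notMem hy]
  have hz := (integral_eq_zero_iff_of_nonneg hnn (hI1.sub hI2)).1 (by
    rw [integral_sub hI1 hI2, hint, sub_self])
  filter_upwards [hz] with y hy
  by_contra! hlt
  have h2 := hle y
  have h3 := hval (Y t y) hlt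
  simp only [Pi.zero_apply] at hy
  linarith

end IsRegular

variable {n : ℕ}

/-- Outside of a null set of labels, `Y` is a sticky flow with unit speed limit whose position is
the projection of the freely transported initial position. -/
structure IsStickyTransport (T : ℝ) (μ : Measure (Space n)) (v₀ : Space n → Space n)
    (Y : ℝ → Space n → Space n) (G : Set (Space n)) : Prop where
  pos : 0 < T
  finite : IsFiniteMeasure μ
  good : ∀ᵐ y ∂μ, y ∈ G
  measurable : ∀ t, Measurable (Y t)
  lipschitz : ∀ y ∈ G, ∀ s ∈ Icc 0 T, ∀ t ∈ Icc 0 T, ‖Y t y - Y s y‖ ≤ |t - s|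
  sticky : ∀ y₁ ∈ G, ∀ y₂ ∈ G, ∀ s t, 0 ≤ s → s ≤ t → t ≤ T → Y s y₁ = Y s y₂ → Y t y₁ = Y t y₂
  projection : ∀ t ∈ Icc 0 T, ∀ φ : Space n → Space n, Measurable φ → ∀ C : ℝ, (∀ x, ‖φ x‖ ≤ C) →
    ∫ y, ⟪Y t y - Y 0 y, φ (Y t y)⟫ ∂μ = t * ∫ y, ⟪v₀ (Y 0 y), φ (Y t y)⟫ ∂μ

/-! ### The position as a conditional expectation of the free motion -/

namespace IsRegular

variable {T : ℝ} {D : Set (Space n)} {X Y : ℝ → Space n → Space n} (hY : IsRegular T D X Y)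
  {ρ : Measure (Space n)} [IsFiniteMeasure ρ] {v₀ : Space n → Space n}
  (h : IsStickyWeakSolution ρ v₀ T D X) (hv : Continuous v₀) (hv1 : ∀ x, ‖v₀ x‖ ≤ 1)
include hY h hv hv1

lemma ae_norm_velocity_le {v : ℝ → Space n → Space n} (hW : IsW T D X (forwardDeriv X 0) v) :
    ∀ᵐ y ∂(labels D), ∀ᵐ t ∂(volume.restrict (Icc 0 T)), ‖v t (Y t y)‖ ≤ 1 := by
  have := hY.finite
  have hm : Measurable fun p : ℝ × Space n => v p.1 (Y p.1 p.2) :=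
    hW.mem.1.comp (measurable_fst.prodMk hY.measurable_uncurry)
  refine (Measure.ae_ae_comm (p := fun t y => ‖v t (Y t y)‖ ≤ 1)
    (measurableSet_le hm.norm measurable_const)).1 ?_
  exact ae_restrict_of_forall_mem measurableSet_Icc fun t ht =>
    hY.norm_velocity_le h hv hv1 hW ht

/-- A continuous path with a right derivative at every time is the integral of that derivative once
it is integrable; the a.e. bound on the velocity supplies this. -/
lemma ae_sub_eq_integral {v : ℝ → Space n → Space n} (hW : IsW T D X (forwardDeriv X 0) v)
    (hweak : ∀ᵐ p ∂(timeLabels T D), forwardDeriv X p.1 p.2 = v p.1 (X p.1 p.2)) :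
    ∀ᵐ y ∂(labels D), ∀ a b, 0 ≤ a → a ≤ b → b ≤ T →
      Y b y - Y a y = ∫ t in a..b, v t (Y t y) := by
  have := hY.finite
  have hm : Measurable fun p : ℝ × Space n => v p.1 (Y p.1 p.2) :=
    hW.mem.1.comp (measurable_fst.prodMk hY.measurable_uncurry)
  have hswap := Measure.ae_ae_of_ae_prod
    ((Measure.measurePreserving_swap (μ := labels D)
      (ν := (volume : Measure ℝ).restrict (Icc 0 T))).quasiMeasurePreserving.ae hweak)
  filter_upwards [hswap, hY.ae_norm_velocity_le h hv hv1 hW, hY.ae_eq, h.flow.differentiable]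
    with y hy hb he hd a b ha hab hbT
  have hsub : Icc a b ⊆ Icc 0 T := Icc_subset_Icc ha hbT
  have hae : ∀ᵐ t ∂(volume.restrict (Icc a b)), forwardDeriv X t y = v t (Y t y) := by
    have h1 := ae_restrict_of_ae_restrict_of_subset hsub hy
    filter_upwards [h1, ae_restrict_mem measurableSet_Icc] with t ht htm
    rw [he t (hsub htm)]
    exact ht
  have hint : IntegrableOn (fun t => v t (Y t y)) (Icc a b) :=
    Integrable.of_bound (hm.comp (measurable_id.prodMk measurable_const)).aestronglyMeasurable 1
      (ae_restrict_of_ae_restrict_of_subset hsub hb)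
  have hftc := intervalIntegral.integral_eq_sub_of_hasDeriv_right_of_le hab
    (f := fun t => Y t y) (f' := fun t => forwardDeriv X t y) (hY.continuous y).continuousOn
    (fun t ht => ?_) ?_
  · rw [← hftc, intervalIntegral.integral_of_le hab, intervalIntegral.integral_of_le hab]
    exact integral_congr_ae (ae_restrict_of_ae_restrict_of_subset Ioc_subset_Icc_self hae)
  · have ht' : t ∈ Ico 0 T := ⟨ha.trans ht.1.le, ht.2.trans_le hbT⟩
    refine ((hd t ht').hasDerivWithinAt.Ioi_of_Ici).congr_of_eventuallyEq ?_
      (he t ⟨ht'.1, ht'.2.le⟩)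
    filter_upwards [Ioo_mem_nhdsGT ht'.2] with s hs
    exact he s ⟨ht'.1.trans hs.1.le, hs.2.le⟩
  · rw [intervalIntegrable_iff_integrableOn_Icc_of_le hab]
    exact hint.congr (hae.mono fun t ht => ht.symm)

theorem isStickyTransport : ∃ G, IsStickyTransport T (labels D) v₀ Y G := by
  have := hY.finite
  obtain ⟨v, hW, hweak⟩ := h.weak
  have hftc := hY.ae_sub_eq_integral h hv hv1 hW hweak
  have hbound := hY.ae_norm_velocity_le h hv hv1 hW
  have hm : Measurable fun p : ℝ × Space n => v p.1 (Y p.1 p.2) :=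
    hW.mem.1.comp (measurable_fst.prodMk hY.measurable_uncurry)
  have hlip : ∀ᵐ y ∂(labels D), ∀ s ∈ Icc 0 T, ∀ t ∈ Icc 0 T, ‖Y t y - Y s y‖ ≤ |t - s| := by
    filter_upwards [hftc, hbound] with y hy hb
    have key : ∀ a b, 0 ≤ a → a ≤ b → b ≤ T → ‖Y b y - Y a y‖ ≤ |b - a| := by
      intro a b ha hab hbT
      rw [hy a b ha hab hbT, ← one_mul |b - a|]
      refine intervalIntegral.norm_integral_le_of_norm_le_const_ae ?_
      rw [ae_restrict_iff' measurableSet_Icc] at hb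
      filter_upwards [hb] with t ht htm
      rw [uIoc_of_le hab] at htm
      exact ht ⟨ha.trans htm.1.le, htm.2.trans hbT⟩
    intro s hs t ht
    rcases le_total s t with hst | hst
    · exact key s t hs.1 hst ht.2
    · rw [norm_sub_rev, abs_sub_comm]
      exact key t s ht.1 hst hs.2
  refine ⟨{y | (y ∈ D ∧ ∀ t ∈ Icc 0 T, Y t y = X t y) ∧
    ∀ s ∈ Icc 0 T, ∀ t ∈ Icc 0 T, ‖Y t y - Y s y‖ ≤ |t - s|}, hY.pos, hY.finite,
    (hY.mem.and hY.ae_eq).and hlip, hY.measurable, fun y hy => hy.2, ?_, ?_⟩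
  · intro y₁ hy₁ y₂ hy₂ s t hs hst ht he
    have hs' : s ∈ Icc 0 T := ⟨hs, hst.trans ht⟩
    have ht' : t ∈ Icc 0 T := ⟨hs.trans hst, ht⟩
    rw [hy₁.1.2 s hs', hy₂.1.2 s hs'] at he
    rw [hy₁.1.2 t ht', hy₂.1.2 t ht']
    exact h.sticky y₁ hy₁.1.1 y₂ hy₂.1.1 s hs' he t ⟨hst, ht⟩
  · intro t ht φ hφ C hC
    have hC0 : 0 ≤ C := (norm_nonneg _).trans (hC 0)
    have hφt : Measurable fun y => φ (Y t y) := hφ.comp (hY.measurable t)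
    have hsub : Ioc 0 t ⊆ Icc 0 T := fun s hs => ⟨hs.1.le, hs.2.trans ht.2⟩
    have hprod : Integrable (Function.uncurry fun s y => ⟪v s (Y s y), φ (Y t y)⟫)
        (((volume : Measure ℝ).restrict (Ioc 0 t)).prod (labels D)) := by
      have hmeas : Measurable (Function.uncurry fun s y => ⟪v s (Y s y), φ (Y t y)⟫) :=
        hm.inner (hφt.comp measurable_snd)
      refine Integrable.of_bound hmeas.aestronglyMeasurable C ?_
      rw [Measure.ae_prod_iff_ae_ae (measurableSet_le hmeas.norm measurable_const)]
      refine ae_restrict_of_forall_mem measurableSet_Ioc fun s hs => ?_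
      filter_upwards [hY.norm_velocity_le h hv hv1 hW (hsub hs)] with y hy
      refine (norm_inner_le_norm _ _).trans ?_
      calc _ ≤ 1 * C := mul_le_mul hy (hC _) (norm_nonneg _) zero_le_one
        _ = C := one_mul C
    have h1 : ∫ y, ⟪Y t y - Y 0 y, φ (Y t y)⟫ ∂(labels D) =
        ∫ y, (∫ s in Ioc 0 t, ⟪v s (Y s y), φ (Y t y)⟫) ∂(labels D) := by
      refine integral_congr_ae ?_
      filter_upwards [hftc, hbound] with y hy hb
      have hint : IntegrableOn (fun s => v s (Y s y)) (Ioc 0 t) :=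
        Integrable.of_bound
          (hm.comp (measurable_id.prodMk measurable_const)).aestronglyMeasurable 1
          (ae_restrict_of_ae_restrict_of_subset hsub hb)
      rw [hy 0 t le_rfl ht.1 ht.2, intervalIntegral.integral_of_le ht.1, real_inner_comm,
        ← integral_inner hint]
      simp_rw [real_inner_comm]
    rw [h1, ← integral_integral_swap hprod]
    -- Since `Y t` factors through `Y s`, the test function is admissible at time `s`, and the
    -- pairing does not depend on `s`; integration over `(0, t]` produces the factor `t`.
    have h2 : ∀ s ∈ Ioc 0 t, ∫ y, ⟪v s (Y s y), φ (Y t y)⟫ ∂(labels D) =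
        ∫ y, ⟪v₀ (Y 0 y), φ (Y t y)⟫ ∂(labels D) := by
      intro s hs
      obtain ⟨f, hf, hYf⟩ := hY.exists_factor h hs.1.le hs.2 ht.2
      have h3 := (hY.integral_inner_velocity h hv hv1 hW (hsub hs) (φ := fun x => φ (f x))
        (hφ.comp hf) (fun x => hC _)).2
      rw [integral_congr_ae (hYf.mono fun y hy => by simp only [hy]; rfl), h3]
      exact integral_congr_ae (hYf.mono fun y hy => by simp only [hy])
    rw [setIntegral_congr_fun measurableSet_Ioc h2]
    simp [ht.1]

end IsRegular

/-- A sticky weak solution is, up to a null set, a sticky transport. -/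
theorem IsStickyWeakSolution.exists_transport {T : ℝ} (hT : 0 < T) {D : Set (Space n)}
    (hD : MeasurableSet D) (hD' : volume D ≠ ⊤) {X : ℝ → Space n → Space n}
    {ρ : Measure (Space n)} [IsFiniteMeasure ρ] {v₀ : Space n → Space n} (hv : Continuous v₀)
    (hv1 : ∀ x, ‖v₀ x‖ ≤ 1) (h : IsStickyWeakSolution ρ v₀ T D X) :
    ∃ Y G, IsStickyTransport T (labels D) v₀ Y G ∧ (labels D).map (Y 0) = ρ := by
  obtain ⟨Y, hYm, hYc, hYe⟩ := h.flow.exists_regular hT.le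
  have hY : IsRegular T D X Y :=
    ⟨hT, ⟨by simpa using hD'.lt_top⟩, ae_restrict_mem hD, hYm, hYc, hYe⟩
  obtain ⟨G, hG⟩ := hY.isStickyTransport h hv hv1
  exact ⟨Y, G, hG, hY.map_zero h⟩

/-! ### Chunks of gas in space -/

section Chunks

variable {n : ℕ}

/-- The inclusion of the plane as the coordinate plane of the axes `i` and `j`. -/
def planar (i j : Fin n) (p : ℝ × ℝ) : Space n :=
  EuclideanSpace.single i p.1 + EuclideanSpace.single j p.2

lemma planar_apply_fst {i j : Fin n} (hij : i ≠ j) (p : ℝ × ℝ) : planar i j p i = p.1 := by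
  simp [planar, hij]

lemma planar_apply_snd {i j : Fin n} (hij : i ≠ j) (p : ℝ × ℝ) : planar i j p j = p.2 := by
  simp [planar, hij.symm]

lemma planar_apply_of_ne {i j l : Fin n} (hi : l ≠ i) (hj : l ≠ j) (p : ℝ × ℝ) :
    planar i j p l = 0 := by
  simp [planar, hi, hj]

lemma planar_add (i j : Fin n) (p q : ℝ × ℝ) : planar i j (p + q) = planar i j p + planar i j q := by
  ext l; simp only [planar, PiLp.add_apply, PiLp.single_apply, Prod.fst_add, Prod.snd_add]
  split_ifs <;> ring

lemma planar_smul (i j : Fin n) (a : ℝ) (p : ℝ × ℝ) : planar i j (a • p) = a • planar i j p := by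
  ext l; simp [planar]

lemma norm_planar_le (i j : Fin n) (p : ℝ × ℝ) : ‖planar i j p‖ ≤ |p.1| + |p.2| := by
  refine (norm_add_le _ _).trans ?_
  simp

/-- The initial velocity of the center of a chunk, in the plane. -/
def drift : ℕ ⊕ ℕ → ℝ × ℝ
  | Sum.inl k => (-speed k, 0)
  | Sum.inr k => (0, -speed k)

lemma free_eq_add (y : ℕ → ℝ) (d : ℕ ⊕ ℕ) (t : ℝ) : free y d t = free y d 0 + t • drift d := by
  rcases d with k | k <;> ext <;> simp [drift] <;> ring

/-- The initial position of the center of a chunk. -/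
def chunkCenter (i j : Fin n) (y : ℕ → ℝ) (d : ℕ ⊕ ℕ) : Space n := planar i j (free y d 0)

/-- The initial velocity of the center of a chunk. -/
def chunkVelocity (i j : Fin n) (d : ℕ ⊕ ℕ) : Space n := planar i j (drift d)

lemma planar_free (i j : Fin n) (y : ℕ → ℝ) (d : ℕ ⊕ ℕ) (t : ℝ) :
    planar i j (free y d t) = chunkCenter i j y d + t • chunkVelocity i j d := by
  rw [free_eq_add, planar_add, planar_smul]; rfl

lemma norm_chunkVelocity_le (i j : Fin n) (d : ℕ ⊕ ℕ) :
    ‖chunkVelocity i j d‖ ≤ speed (level d) := by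
  refine (norm_planar_le _ _ _).trans ?_
  rcases d with k | k <;> simp [drift, abs_of_pos (speed_pos k)]

/-- The radius of the chunks of level `k`. -/
def radius (k : ℕ) : ℝ := speed k * isoTime k

lemma radius_pos (k : ℕ) : 0 < radius k := mul_pos (speed_pos k) (isoTime_pos k)

lemma radius_le (k : ℕ) : radius k ≤ isoTime k / 100 := by
  have := mul_le_mul_of_nonneg_right (speed_le k) (isoTime_pos k).le
  unfold radius; linarith

/-- The ball initially occupied by a chunk. -/
def chunk (i j : Fin n) (y : ℕ → ℝ) (d : ℕ ⊕ ℕ) : Set (Space n) :=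
  Metric.closedBall (chunkCenter i j y d) (radius (level d))

lemma measurableSet_chunk (i j : Fin n) (y : ℕ → ℝ) (d : ℕ ⊕ ℕ) :
    MeasurableSet (chunk i j y d) := Metric.isClosed_closedBall.measurableSet

variable {i j : Fin n} (hij : i ≠ j) {y : ℕ → ℝ} (hy : ∀ k, -reach k ≤ y k ∧ y k ≤ -(reach k / 2))

lemma isoTime_eq (k : ℕ) : isoTime k = reach k / 100 := rfl

-- The abscissae alone separate the balls: those of `inl k` are `reach k > 0`, those of `inr k` lie
-- in `[-reach k, -reach k / 2]`, and `reach` drops by a factor of at least `10 ^ 6` per level.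
include hy in
lemma isoTime_le_abs_free {c d : ℕ ⊕ ℕ} (h : c ≠ d) :
    10 * isoTime (level c) ≤ |(free y c 0).1 - (free y d 0).1| ∧
      10 * isoTime (level d) ≤ |(free y c 0).1 - (free y d 0).1| := by
  have key : ∀ k l, k < l → reach l ≤ reach k / 1000000 ∧ 0 < reach l := fun k l h =>
    ⟨reach_le_of_lt h, reach_pos l⟩
  rcases c with k | k <;> rcases d with l | l <;>
    simp only [isoTime_eq, level_inl, level_inr, free_inl_fst, free_inr_fst, mul_zero, sub_zero]
  · have hkl : k ≠ l := fun e => h (by rw [e])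
    rcases lt_or_gt_of_ne hkl with h | h
    · have := key _ _ h
      rw [abs_of_nonneg (by linarith)]; constructor <;> linarith
    · have := key _ _ h
      rw [abs_of_nonpos (by linarith)]; constructor <;> linarith
  · have := hy l
    have := reach_pos k
    have := reach_pos l
    rw [abs_of_nonneg (by linarith)]; constructor <;> linarith
  · have := hy k
    have := reach_pos k
    have := reach_pos l
    rw [abs_of_nonpos (by linarith)]; constructor <;> linarith
  · have hkl : k ≠ l := fun e => h (by rw [e])
    have h1 := hy k
    have h2 := hy l
    rcases lt_or_gt_of_ne hkl with h | h
    · have := key _ _ h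
      rw [abs_of_nonpos (by linarith)]; constructor <;> linarith
    · have := key _ _ h
      rw [abs_of_nonneg (by linarith)]; constructor <;> linarith

include hij hy in
lemma isoTime_le_dist_chunkCenter {c d : ℕ ⊕ ℕ} (h : c ≠ d) :
    10 * isoTime (level c) ≤ dist (chunkCenter i j y c) (chunkCenter i j y d) ∧
      10 * isoTime (level d) ≤ dist (chunkCenter i j y c) (chunkCenter i j y d) := by
  have h1 := isoTime_le_abs_free hy h
  have h2 : |(free y c 0).1 - (free y d 0).1| ≤
      dist (chunkCenter i j y c) (chunkCenter i j y d) := by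
    have := PiLp.norm_apply_le (chunkCenter i j y c - chunkCenter i j y d) i
    rwa [← dist_eq_norm, PiLp.sub_apply, chunkCenter, chunkCenter, planar_apply_fst hij,
      planar_apply_fst hij, Real.norm_eq_abs] at this
  exact ⟨h1.1.trans h2, h1.2.trans h2⟩

include hij hy in
/-- The balls of twice the radii of two different chunks are disjoint. -/
lemma eq_of_dist_chunkCenter_lt {c d : ℕ ⊕ ℕ} {x : Space n}
    (hc : dist x (chunkCenter i j y c) ≤ 2 * radius (level c))
    (hd : dist x (chunkCenter i j y d) ≤ 2 * radius (level d)) : c = d := by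
  by_contra h
  have h1 := isoTime_le_dist_chunkCenter hij hy h
  have h2 := dist_triangle_left (chunkCenter i j y c) (chunkCenter i j y d) x
  have := radius_le (level c)
  have := radius_le (level d)
  have := isoTime_pos (level c)
  have := isoTime_pos (level d)
  linarith

include hij hy in
lemma eq_of_mem_chunk {c d : ℕ ⊕ ℕ} {x : Space n} (hc : x ∈ chunk i j y c)
    (hd : x ∈ chunk i j y d) : c = d :=
  eq_of_dist_chunkCenter_lt hij hy
    (hc.trans (by linarith [radius_pos (level c)])) (hd.trans (by linarith [radius_pos (level d)]))

include hy in
lemma norm_chunkCenter_le (d : ℕ ⊕ ℕ) : ‖chunkCenter i j y d‖ ≤ 1 := by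
  refine (norm_planar_le _ _ _).trans ?_
  have h1 : ∀ k, reach k ≤ 1 / 100 := fun k => by
    have := scale_le_pow k
    have := pow_le_one₀ (n := k) (by norm_num : (0 : ℝ) ≤ 1 / 2) (by norm_num)
    linarith [reach_le_scale k]
  have h2 : ∀ k, speed k * scale k ≤ 1 / 100 := h1
  have h3 := reach_pos (level d)
  rcases d with k | k
  · have := h1 k
    simp only [level_inl] at h3
    simp only [free_inl_fst, free_inl_snd, mul_zero, sub_zero, abs_zero, abs_of_pos h3]
    linarith
  · have := h1 k
    have := h2 k
    have := hy k
    simp only [level_inr] at h3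
    have h4 : 0 ≤ speed k * scale k := h3.le
    have h5 : speed k * (2 * scale k - 0) = 2 * (speed k * scale k) := by ring
    simp only [free_inr_fst, free_inr_snd]
    rw [h5, abs_of_nonpos (by linarith), abs_of_nonneg (by linarith)]
    linarith

end Chunks

/-! ### Masses -/

lemma exists_pos_le_of_decay {a : ℕ → ℝ} (ha : ∀ k, 0 < a k) :
    ∃ m : ℕ → ℝ, (∀ k, 0 < m k) ∧ (∀ k, m k ≤ a k) ∧ ∀ k, m (k + 1) ≤ m k / 100 := by
  let m : ℕ → ℝ := fun k => Nat.rec (a 0) (fun k x => min (a (k + 1)) (x / 100)) k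
  have hs : ∀ k, m (k + 1) = min (a (k + 1)) (m k / 100) := fun k => rfl
  refine ⟨m, fun k => ?_, fun k => ?_, fun k => ?_⟩
  · induction k with
    | zero => exact ha 0
    | succ k ih => rw [hs]; exact lt_min (ha _) (by positivity)
  · cases k with
    | zero => exact le_rfl
    | succ k => rw [hs]; exact min_le_left _ _
  · rw [hs]; exact min_le_right _ _

/-- Masses of total one which are small with respect to given bounds. -/
lemma exists_isMass {a : ℕ → ℝ} (ha : ∀ k, 0 < a k) :
    ∃ (m : ℕ ⊕ ℕ → ℝ) (S : ℝ), IsMass m ∧ ∑' d, m d = 1 ∧ 0 < S ∧ ∀ d, m d ≤ S * a (level d) := by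
  obtain ⟨μ, hpos, hle, hsucc⟩ := exists_pos_le_of_decay
    (a := fun k => min (a k) ((1 / 2) ^ k)) fun k => lt_min (ha k) (by positivity)
  let m : ℕ ⊕ ℕ → ℝ := Sum.elim μ fun k => μ k / 100
  have hm : ∀ d, 0 < m d := by
    rintro (k | k)
    · exact hpos k
    · exact div_pos (hpos k) (by norm_num)
  have hμ : Summable μ := Summable.of_nonneg_of_le (fun k => (hpos k).le)
    (fun k => (hle k).trans (min_le_right _ _)) (summable_geometric_two)
  have hsum : Summable m := Summable.sum _ hμ (hμ.div_const 100)
  have hS : 0 < ∑' d, m d := hsum.tsum_pos (fun d => (hm d).le) (Sum.inl 0) (hm _)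
  have hSi : 0 < (∑' d, m d)⁻¹ := inv_pos.2 hS
  refine ⟨fun d => (∑' d, m d)⁻¹ * m d, (∑' d, m d)⁻¹, ⟨fun d => mul_pos hSi (hm d),
    hsum.mul_left _, fun k => ?_, fun k => ?_, fun k => ?_⟩, ?_, hSi, fun d => ?_⟩
  · rw [mul_div_assoc]
    exact mul_le_mul_of_nonneg_left (hsucc k) hSi.le
  · rw [mul_div_assoc]
    exact mul_le_mul_of_nonneg_left (div_le_div_of_nonneg_right (hsucc k) (by norm_num)) hSi.le
  · rw [mul_div_assoc]
    exact mul_le_mul_of_nonneg_left le_rfl hSi.le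
  · rw [tsum_mul_left, inv_mul_cancel₀ hS.ne']
  · refine mul_le_mul_of_nonneg_left ?_ hSi.le
    rcases d with k | k
    · exact (hle k).trans (min_le_left _ _)
    · have : μ k / 100 ≤ μ k := by linarith [hpos k]
      exact this.trans ((hle k).trans (min_le_left _ _))

lemma IsMass.exists_isTarget {m : ℕ ⊕ ℕ → ℝ} (hm : IsMass m) : ∃ y, IsTarget m y := by
  have hs : Summable fun j => m (Sum.inl j) := hm.summable.comp_injective Sum.inl_injective
  let f : ℕ → ℕ → ℝ := fun k j => if k ≤ j then m (Sum.inl j) else 0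
  have hf0 : ∀ k j, 0 ≤ f k j := fun k j => by
    simp only [f]; split_ifs
    exacts [(hm.pos _).le, le_rfl]
  have hf : ∀ k, Summable (f k) := fun k => Summable.of_nonneg_of_le (hf0 k) (fun j => by
    simp only [f]; split_ifs
    exacts [le_rfl, (hm.pos _).le]) hs
  have hb : ∀ k j, |reach j - speed j * (2 * scale k)| ≤ 1 := fun k j => by
    have h1 := reach_le_scale j
    have h2 : ∀ j, scale j ≤ 1 := fun j => (scale_le_pow j).trans
      (pow_le_one₀ (by norm_num) (by norm_num))
    have h3 : speed j * (2 * scale k) ≤ 1 / 100 * (2 * 1) := by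
      have := h2 k
      have := speed_le j
      have := scale_pos k
      gcongr
    have h4 : 0 < speed j * (2 * scale k) := by
      have := speed_pos j
      have := scale_pos k
      positivity
    have := reach_pos j
    rw [abs_le]; constructor <;> linarith [h2 j]
  have hg : ∀ k, Summable fun j => f k j * (reach j - speed j * (2 * scale k)) := fun k =>
    Summable.of_norm_bounded (hf k) fun j => by
      rw [norm_mul, Real.norm_of_nonneg (hf0 k j)]
      exact mul_le_of_le_one_right (hf0 k j) (hb k j)
  refine ⟨fun k => (∑' j, f k j * (reach j - speed j * (2 * scale k))) / ∑' j, f k j, fun k => ?_⟩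
  have hpos : 0 < ∑' j, f k j := (hf k).tsum_pos (hf0 k) k (by simpa [f] using hm.pos _)
  set z := (∑' j, f k j * (reach j - speed j * (2 * scale k))) / ∑' j, f k j with hz
  have : (fun j => if k ≤ j then m (Sum.inl j) * (reach j - speed j * (2 * scale k) - z) else 0) =
      fun j => f k j * (reach j - speed j * (2 * scale k)) - f k j * z := by
    funext j; simp only [f]; split_ifs <;> ring
  change ∑' j, (if k ≤ j then m (Sum.inl j) * (reach j - speed j * (2 * scale k) - z) else 0) = 0
  rw [this, (hg k).tsum_sub ((hf k).mul_right z), tsum_mul_right, hz,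
    mul_div_cancel₀ _ hpos.ne', sub_self]

/-- Supplies the mass bound under which the bump of level `k` has its first `k` derivatives summable
over all levels. -/
lemma exists_pos_mul_iteratedFDeriv_le {E : Type*} [NormedAddCommGroup E] [NormedSpace ℝ E]
    {f : E → ℝ} (hf : ContDiff ℝ ∞ f) (hf' : HasCompactSupport f) (k : ℕ) :
    ∃ c : ℝ, 0 < c ∧ ∀ N ≤ k, ∀ x, c * ‖iteratedFDeriv ℝ N f x‖ ≤ (1 / 2) ^ k := by
  have h : ∀ N, ∃ C, ∀ x, ‖iteratedFDeriv ℝ N f x‖ ≤ C := fun N =>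
    (hf'.iteratedFDeriv N).exists_bound_of_continuous
      (hf.continuous_iteratedFDeriv (by exact_mod_cast le_top))
  choose C hC using h
  let B := 1 + ∑ N ∈ Finset.range (k + 1), |C N|
  have hB : 0 < B := by positivity
  refine ⟨(1 / 2) ^ k / B, by positivity, fun N hN x => ?_⟩
  have : ‖iteratedFDeriv ℝ N f x‖ ≤ B := by
    have h1 := Finset.single_le_sum (f := fun N => |C N|) (fun _ _ => abs_nonneg _)
      (Finset.mem_range.2 (Nat.lt_succ_of_le hN))
    have := (hC N x).trans (le_abs_self _)
    simp only [B]; linarith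
  rw [div_mul_eq_mul_div, div_le_iff₀ hB]
  gcongr

/-! ### The initial density -/

section Density

variable {n : ℕ}

/-- A smooth probability density supported in the ball of radius `radius k`. -/
def bump (n k : ℕ) : Space n → ℝ :=
  (⟨radius k / 2, radius k, half_pos (radius_pos k), half_lt_self (radius_pos k)⟩ :
    ContDiffBump (0 : Space n)).normed volume

lemma contDiff_bump (k : ℕ) : ContDiff ℝ ∞ (bump n k) := ContDiffBump.contDiff_normed _

lemma hasCompactSupport_bump (k : ℕ) : HasCompactSupport (bump n k) :=
  ContDiffBump.hasCompactSupport_normed _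

lemma bump_nonneg (k : ℕ) (x : Space n) : 0 ≤ bump n k x := ContDiffBump.nonneg_normed _ x

lemma bump_neg (k : ℕ) (x : Space n) : bump n k (-x) = bump n k x := ContDiffBump.normed_neg _ x

lemma integral_bump (k : ℕ) : ∫ x, bump n k x = 1 := ContDiffBump.integral_normed _

lemma bump_eq_zero {k : ℕ} {x : Space n} (h : radius k < ‖x‖) : bump n k x = 0 := by
  by_contra hx
  have : x ∈ Function.support (bump n k) := hx
  rw [bump, ContDiffBump.support_normed_eq, mem_ball_zero_iff] at this
  exact lt_asymm h this

lemma integral_bump_smul (k : ℕ) : ∫ x, bump n k x • x = 0 := by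
  have h := integral_neg_eq_self (fun x : Space n => bump n k x • x) volume
  simp only [bump_neg, smul_neg, integral_neg] at h
  have h2 : (2 : ℝ) • ∫ x : Space n, bump n k x • x = 0 := by
    rw [two_smul]; nth_rewrite 1 [← h]; exact neg_add_cancel _
  exact (smul_eq_zero.1 h2).resolve_left two_ne_zero

/-- The density of the chunks with masses `m`. -/
def density (i j : Fin n) (m : ℕ ⊕ ℕ → ℝ) (y : ℕ → ℝ) (x : Space n) : ℝ :=
  ∑' d, m d * bump n (level d) (x - chunkCenter i j y d)

variable {i j : Fin n} (hij : i ≠ j) {m : ℕ ⊕ ℕ → ℝ} (hm : IsMass m) {y : ℕ → ℝ}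
  (hy : ∀ k, -reach k ≤ y k ∧ y k ≤ -(reach k / 2))

lemma bump_sub_eq_zero {d : ℕ ⊕ ℕ} {x : Space n} (h : x ∉ chunk i j y d) :
    bump n (level d) (x - chunkCenter i j y d) = 0 := by
  refine bump_eq_zero ?_
  rwa [← dist_eq_norm, ← not_le]

include hm in
lemma density_nonneg (x : Space n) : 0 ≤ density i j m y x :=
  tsum_nonneg fun d => mul_nonneg (hm.pos d).le (bump_nonneg _ _)

include hij hy in
lemma density_eq_of_mem {d : ℕ ⊕ ℕ} {x : Space n} (h : x ∈ chunk i j y d) :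
    density i j m y x = m d * bump n (level d) (x - chunkCenter i j y d) :=
  tsum_eq_single d fun c hc => by
    rw [bump_sub_eq_zero fun hx => hc (eq_of_mem_chunk hij hy hx h), mul_zero]

lemma exists_mem_chunk_of_density_ne_zero {x : Space n} (h : density i j m y x ≠ 0) :
    ∃ d, x ∈ chunk i j y d := by
  by_contra! hx
  refine h ?_
  simp only [density, bump_sub_eq_zero (hx _), mul_zero, tsum_zero]

include hy in
lemma chunk_subset (d : ℕ ⊕ ℕ) : chunk i j y d ⊆ Metric.closedBall 0 2 := by
  intro x hx
  rw [chunk, Metric.mem_closedBall] at hx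
  rw [Metric.mem_closedBall]
  have h1 := dist_triangle x (chunkCenter i j y d) 0
  rw [dist_zero_right (chunkCenter i j y d)] at h1
  have h2 := norm_chunkCenter_le (i := i) (j := j) hy d
  have h3 := radius_le (level d)
  have h4 := isoTime_le_scale (level d)
  have h5 := (scale_le_pow (level d)).trans (pow_le_one₀ (by norm_num) (by norm_num))
  linarith [isoTime_pos (level d)]

include hy in
lemma hasCompactSupport_density : HasCompactSupport (density i j m y) := by
  refine HasCompactSupport.intro (isCompact_closedBall (0 : Space n) 2) fun x hx => ?_
  by_contra h
  obtain ⟨d, hd⟩ := exists_mem_chunk_of_density_ne_zero h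
  exact hx (chunk_subset hy d hd)

lemma finite_level_lt (N : ℕ) : {d : ℕ ⊕ ℕ | level d < N}.Finite := by
  refine (((Finset.range N).disjSum (Finset.range N)).finite_toSet).subset ?_
  rintro (k | k) hk <;> simpa using hk

lemma summable_half_pow_level : Summable fun d => (1 / 2 : ℝ) ^ level d :=
  Summable.sum _ summable_geometric_two summable_geometric_two

include hm in
lemma contDiff_density {S : ℝ} (h : ∀ d, ∀ N ≤ level d, ∀ x,
    m d * ‖iteratedFDeriv ℝ N (bump n (level d)) x‖ ≤ S * (1 / 2) ^ level d) :
    ContDiff ℝ ∞ (density i j m y) := by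
  have hb : ∀ d, ContDiff ℝ ∞ fun x => bump n (level d) (x - chunkCenter i j y d) := fun d =>
    (contDiff_bump _).comp (contDiff_id.sub contDiff_const)
  -- Derivatives of order `N` are controlled only for levels at least `N`, that is, for all but
  -- finitely many particles.
  refine contDiff_tsum_of_eventually (v := fun _ d => S * (1 / 2) ^ level d)
    (fun d => contDiff_const.mul (hb d)) (fun _ _ => summable_half_pow_level.mul_left S)
    fun N _ => ?_
  filter_upwards [(finite_level_lt N).compl_mem_cofinite] with d hd x
  have hd : N ≤ level d := not_lt.1 hd
  have h1 := iteratedFDeriv_const_smul_apply (𝕜 := ℝ) (a := m d) (i := N) (x := x)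
    (((hb d).of_le (by exact_mod_cast le_top)).contDiffAt)
  have h2 := iteratedFDeriv_comp_sub (𝕜 := ℝ) (f := bump n (level d)) N (chunkCenter i j y d) x
  change ‖iteratedFDeriv ℝ N (m d • fun x => bump n (level d) (x - chunkCenter i j y d)) x‖ ≤ _
  rw [h1, h2, norm_smul, Real.norm_of_nonneg (hm.pos d).le]
  exact h d N hd _

include hm in
lemma integral_density : ∫ x, density i j m y x = ∑' d, m d := by
  have h1 : ∀ d, Integrable fun x => m d * bump n (level d) (x - chunkCenter i j y d) := fun d =>
    (((contDiff_bump _).continuous.integrable_of_hasCompactSupport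
      (hasCompactSupport_bump _)).comp_sub_right _).const_mul _
  have h2 : ∀ d, ∫ x, m d * bump n (level d) (x - chunkCenter i j y d) = m d := fun d => by
    rw [integral_const_mul, integral_sub_right_eq_self (bump n (level d)), integral_bump, mul_one]
  have h3 : ∀ d, ∫ x, ‖m d * bump n (level d) (x - chunkCenter i j y d)‖ = m d := fun d => by
    rw [← h2 d]
    congr 1 with x
    rw [h2 d, Real.norm_of_nonneg (mul_nonneg (hm.pos d).le (bump_nonneg _ _))]
  have h4 := hasSum_integral_of_summable_integral_norm h1 (by simpa only [h3] using hm.summable)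
  simp only [h2] at h4
  exact h4.tsum_eq.symm

include hij hy in
lemma setIntegral_density_smul {F : Type*} [NormedAddCommGroup F] [NormedSpace ℝ F] (d : ℕ ⊕ ℕ)
    (g : Space n → F) :
    ∫ x in chunk i j y d, density i j m y x • g (x - chunkCenter i j y d) =
      m d • ∫ x, bump n (level d) x • g x := by
  have h1 : ∫ x in chunk i j y d, density i j m y x • g (x - chunkCenter i j y d) =
      ∫ x in chunk i j y d, m d • (bump n (level d) (x - chunkCenter i j y d) •
        g (x - chunkCenter i j y d)) := by
    refine setIntegral_congr_fun (measurableSet_chunk i j y d) fun x hx => ?_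
    simp only [density_eq_of_mem hij hy hx, mul_smul]
  rw [h1, setIntegral_eq_integral_of_forall_compl_eq_zero, integral_smul,
    integral_sub_right_eq_self (fun x => bump n (level d) x • g x)]
  intro x hx
  rw [bump_sub_eq_zero hx, zero_smul, smul_zero]

end Density

/-! ### The initial velocity -/

section Velocity

variable {n : ℕ}

/-- A bump function equal to one on a chunk. -/
def cutoff (i j : Fin n) (y : ℕ → ℝ) (d : ℕ ⊕ ℕ) : ContDiffBump (chunkCenter i j y d) :=
  ⟨radius (level d), 2 * radius (level d), radius_pos _, by linarith [radius_pos (level d)]⟩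

/-- The part of the velocity field carried by a chunk, which focuses it to a point. -/
def chunkField (i j : Fin n) (y : ℕ → ℝ) (d : ℕ ⊕ ℕ) (x : Space n) : Space n :=
  cutoff i j y d x •
    (chunkVelocity i j d - (isoTime (level d))⁻¹ • (x - chunkCenter i j y d))

/-- The initial velocity field. -/
def velocity (i j : Fin n) (y : ℕ → ℝ) (x : Space n) : Space n := ∑' d, chunkField i j y d x

variable {i j : Fin n} {y : ℕ → ℝ}

lemma dist_le_of_chunkField_ne_zero {d : ℕ ⊕ ℕ} {x : Space n} (h : chunkField i j y d x ≠ 0) :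
    dist x (chunkCenter i j y d) ≤ 2 * radius (level d) := by
  by_contra! hx
  exact h (by rw [chunkField, (cutoff i j y d).zero_of_le_dist hx.le, zero_smul])

/-- Because `radius k` is `speed k * isoTime k`, the focusing velocity is at most twice `speed k`
even on the doubled ball. The fields thus tend to zero uniformly, which makes their sum continuous
although the balls accumulate at the origin. -/
lemma norm_chunkField_le (d : ℕ ⊕ ℕ) (x : Space n) :
    ‖chunkField i j y d x‖ ≤ 3 * speed (level d) := by
  have hs := speed_pos (level d)
  by_cases h : chunkField i j y d x = 0
  · rw [h, norm_zero]; positivity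
  have h1 := dist_le_of_chunkField_ne_zero h
  rw [dist_eq_norm] at h1
  have hi := isoTime_pos (level d)
  have h2 : ‖chunkVelocity i j d - (isoTime (level d))⁻¹ • (x - chunkCenter i j y d)‖ ≤
      3 * speed (level d) := by
    calc _ ≤ ‖chunkVelocity i j d‖ + ‖(isoTime (level d))⁻¹ • (x - chunkCenter i j y d)‖ :=
          norm_sub_le _ _
      _ ≤ speed (level d) + (isoTime (level d))⁻¹ * (2 * radius (level d)) := by
          rw [norm_smul, norm_inv, Real.norm_of_nonneg hi.le]
          gcongr
          exact norm_chunkVelocity_le i j d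
      _ = 3 * speed (level d) := by
          unfold radius; field_simp; ring
  rw [chunkField, norm_smul, Real.norm_of_nonneg (cutoff i j y d).nonneg]
  exact (mul_le_of_le_one_left (norm_nonneg _) (cutoff i j y d).le_one).trans h2

lemma summable_speed_level : Summable fun d => 3 * speed (level d) := by
  have : Summable speed := by
    have := summable_geometric_of_lt_one (r := (1 / 100 : ℝ)) (by norm_num) (by norm_num)
    exact (summable_nat_add_iff (f := fun k => (1 / 100 : ℝ) ^ k) 1).2 this
  have h : Summable fun d => speed (level d) := Summable.sum _ this this
  exact h.mul_left 3

lemma continuous_velocity : Continuous (velocity i j y) := by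
  refine continuous_tsum (fun d => ?_) summable_speed_level norm_chunkField_le
  exact (cutoff i j y d).continuous.smul (by fun_prop)

variable (hij : i ≠ j) (hy : ∀ k, -reach k ≤ y k ∧ y k ≤ -(reach k / 2))

include hij hy in
lemma velocity_eq_of_dist_le {d : ℕ ⊕ ℕ} {x : Space n}
    (h : dist x (chunkCenter i j y d) ≤ 2 * radius (level d)) :
    velocity i j y x = chunkField i j y d x :=
  tsum_eq_single d fun c hc => by
    by_contra hx
    exact hc (eq_of_dist_chunkCenter_lt hij hy (dist_le_of_chunkField_ne_zero hx) h)

include hij hy in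
lemma velocity_eq_of_mem {d : ℕ ⊕ ℕ} {x : Space n} (h : x ∈ chunk i j y d) :
    velocity i j y x =
      chunkVelocity i j d - (isoTime (level d))⁻¹ • (x - chunkCenter i j y d) := by
  have h' : dist x (chunkCenter i j y d) ≤ radius (level d) := h
  rw [velocity_eq_of_dist_le hij hy (h'.trans (by linarith [radius_pos (level d)])), chunkField,
    (cutoff i j y d).one_of_mem_closedBall h, one_smul]

lemma exists_dist_le_of_velocity_ne_zero {x : Space n} (h : velocity i j y x ≠ 0) :
    ∃ d, dist x (chunkCenter i j y d) ≤ 2 * radius (level d) := by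
  by_contra! hx
  refine h ?_
  have : ∀ d, chunkField i j y d x = 0 := fun d => by
    by_contra hd
    exact (hx d).not_ge (dist_le_of_chunkField_ne_zero hd)
  simp only [velocity, this, tsum_zero]

include hij hy in
lemma norm_velocity_le (x : Space n) : ‖velocity i j y x‖ ≤ 1 := by
  by_cases h : velocity i j y x = 0
  · rw [h, norm_zero]; exact zero_le_one
  obtain ⟨d, hd⟩ := exists_dist_le_of_velocity_ne_zero h
  rw [velocity_eq_of_dist_le hij hy hd]
  exact (norm_chunkField_le d x).trans (by linarith [speed_le (level d)])

include hy in
lemma hasCompactSupport_velocity : HasCompactSupport (velocity i j y) := by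
  refine HasCompactSupport.intro (isCompact_closedBall (0 : Space n) 2) fun x hx => ?_
  by_contra h
  obtain ⟨d, hd⟩ := exists_dist_le_of_velocity_ne_zero h
  refine hx ?_
  rw [Metric.mem_closedBall]
  have h1 := dist_triangle x (chunkCenter i j y d) 0
  rw [dist_zero_right (chunkCenter i j y d)] at h1
  have h2 := norm_chunkCenter_le (i := i) (j := j) hy d
  have h3 := radius_le (level d)
  have h4 := isoTime_le_scale (level d)
  have h5 := (scale_le_pow (level d)).trans (pow_le_one₀ (by norm_num) (by norm_num))
  linarith [isoTime_pos (level d)]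

end Velocity

/-! ### The initial data -/

/-- Initial data `ρ`, `v₀` made of chunks with masses `m` and targets `y`, focusing to points. -/
structure IsChunkData {n : ℕ} (i j : Fin n) (m : ℕ ⊕ ℕ → ℝ) (y : ℕ → ℝ) (ρ : Measure (Space n))
    (v₀ : Space n → Space n) : Prop where
  mass : IsMass m
  target : IsTarget m y
  continuous : Continuous v₀
  norm_le : ∀ x, ‖v₀ x‖ ≤ 1
  velocity : ∀ d, ∀ x ∈ chunk i j y d,
    v₀ x = chunkVelocity i j d - (isoTime (level d))⁻¹ • (x - chunkCenter i j y d)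
  real_chunk : ∀ d, ρ.real (chunk i j y d) = m d
  centered : ∀ d, ∫ x in chunk i j y d, (x - chunkCenter i j y d) ∂ρ = 0
  covered : ∀ᵐ x ∂ρ, ∃ d, x ∈ chunk i j y d

theorem exists_isChunkData {n : ℕ} {i j : Fin n} (hij : i ≠ j) :
    ∃ (r : Space n → ℝ) (v₀ : Space n → Space n),
      ContDiff ℝ ∞ r ∧ HasCompactSupport r ∧ (∀ x, 0 ≤ r x) ∧ ∫ x, r x = 1 ∧
      Continuous v₀ ∧ HasCompactSupport v₀ ∧ ∃ m y,
        IsChunkData i j m y (volume.withDensity fun x => ENNReal.ofReal (r x)) v₀ := by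
  choose a ha hab using fun k =>
    exists_pos_mul_iteratedFDeriv_le (contDiff_bump (n := n) k) (hasCompactSupport_bump k) k
  obtain ⟨m, S, hm, hm1, hS, hmS⟩ := exists_isMass ha
  obtain ⟨y, hmy⟩ := hm.exists_isTarget
  have hy := hm.target_bounds hmy
  have hr : ContDiff ℝ ∞ (density i j m y) := contDiff_density hm fun d N hN x => by
    calc _ ≤ S * a (level d) * ‖iteratedFDeriv ℝ N (bump n (level d)) x‖ := by
          gcongr; exact hmS d
      _ = S * (a (level d) * ‖iteratedFDeriv ℝ N (bump n (level d)) x‖) := mul_assoc _ _ _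
      _ ≤ S * (1 / 2) ^ level d := by
          gcongr; exact hab _ N hN x
  have hr0 := density_nonneg (i := i) (j := j) (y := y) hm
  have hmeas : Measurable fun x => ENNReal.ofReal (density i j m y x) :=
    hr.continuous.measurable.ennreal_ofReal
  -- Used with `g = 1` for the mass of a ball and with `g = id` for its centering, where the
  -- evenness of the bump enters.
  have key : ∀ (d : ℕ ⊕ ℕ) {F : Type} [NormedAddCommGroup F] [NormedSpace ℝ F]
      (g : Space n → F), ∫ x in chunk i j y d, g (x - chunkCenter i j y d)
        ∂(volume.withDensity fun x => ENNReal.ofReal (density i j m y x)) =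
      m d • ∫ x, bump n (level d) x • g x := by
    intro d F _ _ g
    rw [setIntegral_withDensity_eq_setIntegral_toReal_smul hmeas
      (ae_of_all _ fun x => ENNReal.ofReal_lt_top) _ (measurableSet_chunk i j y d),
      ← setIntegral_density_smul hij hy]
    simp only [ENNReal.toReal_ofReal (hr0 _)]
  refine ⟨density i j m y, velocity i j y, hr, hasCompactSupport_density hy, hr0,
    (integral_density hm).trans hm1, continuous_velocity, hasCompactSupport_velocity hy, m, y,
    hm, hmy, continuous_velocity, norm_velocity_le hij hy,
    fun d x hx => velocity_eq_of_mem hij hy hx, fun d => ?_, fun d => ?_, ?_⟩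
  · have := key d fun _ => (1 : ℝ)
    simpa [integral_bump, setIntegral_const] using this
  · rw [key d fun x => x, integral_bump_smul, smul_zero]
  · rw [ae_withDensity_iff hmeas]
    refine ae_of_all _ fun x hx => exists_mem_chunk_of_density_ne_zero (m := m) fun h => hx ?_
    rw [h, ENNReal.ofReal_zero]

/-! ### Motion of the chunks -/

/-- A sticky transport whose initial data are made of chunks. -/
structure IsChunkTransport {n : ℕ} (i j : Fin n) (T : ℝ) (m : ℕ ⊕ ℕ → ℝ) (y : ℕ → ℝ)
    (μ : Measure (Space n)) (v₀ : Space n → Space n) (Y : ℝ → Space n → Space n)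
    (G : Set (Space n)) : Prop where
  ne : i ≠ j
  data : IsChunkData i j m y (μ.map (Y 0)) v₀
  transport : IsStickyTransport T μ v₀ Y G

/-- The labels of a chunk. -/
def part {n : ℕ} (i j : Fin n) (y : ℕ → ℝ) (Y : ℝ → Space n → Space n) (d : ℕ ⊕ ℕ) :
    Set (Space n) := Y 0 ⁻¹' chunk i j y d

/-- The center of mass of a chunk at time `t`. -/
def meanPos {n : ℕ} (i j : Fin n) (y : ℕ → ℝ) (μ : Measure (Space n))
    (Y : ℝ → Space n → Space n) (d : ℕ ⊕ ℕ) (t : ℝ) : Space n :=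
  ⨍ x in part i j y Y d, Y t x ∂μ

namespace IsChunkTransport

variable {n : ℕ} {i j : Fin n} {T : ℝ} {m : ℕ ⊕ ℕ → ℝ} {y : ℕ → ℝ} {μ : Measure (Space n)}
  {v₀ : Space n → Space n} {Y : ℝ → Space n → Space n} {G : Set (Space n)}
  (h : IsChunkTransport i j T m y μ v₀ Y G)
include h

lemma target_bounds (k : ℕ) : -reach k ≤ y k ∧ y k ≤ -(reach k / 2) :=
  h.data.mass.target_bounds h.data.target k

lemma measurableSet_part (d : ℕ ⊕ ℕ) : MeasurableSet (part i j y Y d) :=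
  h.transport.measurable 0 (measurableSet_chunk i j y d)

lemma real_part (d : ℕ ⊕ ℕ) : μ.real (part i j y Y d) = m d := by
  rw [← h.data.real_chunk d,
    map_measureReal_apply (h.transport.measurable 0) (measurableSet_chunk i j y d)]
  rfl

lemma measure_part_ne_zero (d : ℕ ⊕ ℕ) : μ (part i j y Y d) ≠ 0 := by
  intro h0
  have := h.real_part d
  rw [measureReal_def, h0, ENNReal.toReal_zero] at this
  exact (h.data.mass.pos d).ne this

lemma pairwise_disjoint_part : Pairwise (Function.onFun Disjoint (part i j y Y)) := by
  intro c d hcd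
  exact Set.disjoint_left.2 fun x hc hd => hcd (eq_of_mem_chunk h.ne h.target_bounds hc hd)

lemma ae_mem_part : ∀ᵐ x ∂μ, ∃ d, x ∈ part i j y Y d :=
  ae_of_ae_map (h.transport.measurable 0).aemeasurable h.data.covered

lemma norm_sub_le {d : ℕ ⊕ ℕ} {x : Space n} (hG : x ∈ G) (hx : x ∈ part i j y Y d) {t : ℝ}
    (ht : t ∈ Icc 0 T) : ‖Y t x - chunkCenter i j y d‖ ≤ t + radius (level d) := by
  have h1 := h.transport.lipschitz x hG 0 ⟨le_rfl, h.transport.pos.le⟩ t ht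
  rw [sub_zero, abs_of_nonneg ht.1] at h1
  have h2 : ‖Y 0 x - chunkCenter i j y d‖ ≤ radius (level d) := by
    rw [← dist_eq_norm]; exact hx
  calc _ ≤ ‖Y t x - Y 0 x‖ + ‖Y 0 x - chunkCenter i j y d‖ := norm_sub_le_norm_sub_add_norm_sub _ _ _
    _ ≤ _ := add_le_add h1 h2

lemma integrable {t : ℝ} (ht : t ∈ Icc 0 T) : Integrable (Y t) μ := by
  have := h.transport.finite
  refine Integrable.of_bound (h.transport.measurable t).aestronglyMeasurable (T + 2) ?_
  filter_upwards [h.transport.good, h.ae_mem_part] with x hG ⟨d, hd⟩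
  have h1 := h.norm_sub_le hG hd ht
  have h2 := norm_le_norm_add_norm_sub' (Y t x) (chunkCenter i j y d)
  have h3 := norm_chunkCenter_le (i := i) (j := j) h.target_bounds d
  have h4 := radius_le (level d)
  have h5 := isoTime_le_scale (level d)
  have h6 := (scale_le_pow (level d)).trans (pow_le_one₀ (by norm_num) (by norm_num))
  linarith [ht.2, isoTime_pos (level d)]

lemma integrable_velocity : Integrable (fun x => v₀ (Y 0 x)) μ := by
  have := h.transport.finite
  exact Integrable.of_bound
    (h.data.continuous.measurable.comp (h.transport.measurable 0)).aestronglyMeasurable 1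
    (ae_of_all _ fun x => h.data.norm_le _)

lemma integrable_defect {t : ℝ} (ht : t ∈ Icc 0 T) :
    Integrable (fun x => Y t x - (Y 0 x + t • v₀ (Y 0 x))) μ :=
  (h.integrable ht).sub ((h.integrable ⟨le_rfl, h.transport.pos.le⟩).add
    (h.integrable_velocity.smul t))

lemma integral_inner_defect {t : ℝ} (ht : t ∈ Icc 0 T) {φ : Space n → Space n}
    (hφ : Measurable φ) {C : ℝ} (hC : ∀ x, ‖φ x‖ ≤ C) :
    ∫ x, ⟪Y t x - (Y 0 x + t • v₀ (Y 0 x)), φ (Y t x)⟫ ∂μ = 0 := by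
  have hm := (hφ.comp (h.transport.measurable t)).aestronglyMeasurable (μ := μ)
  have h1 := integrable_inner_of_bound ((h.integrable ht).sub
    (h.integrable ⟨le_rfl, h.transport.pos.le⟩)) hm (fun x => hC _)
  have h2 := integrable_inner_of_bound h.integrable_velocity hm (fun x => hC _)
  have h3 := integral_sub h1 (h2.const_mul t)
  rw [integral_const_mul] at h3
  have h4 := h.transport.projection t ht φ hφ C hC
  calc _ = ∫ x, ⟪(Y t - Y 0) x, (φ ∘ Y t) x⟫ - t * ⟪v₀ (Y 0 x), (φ ∘ Y t) x⟫ ∂μ := by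
        congr 1 with x
        rw [← sub_sub, inner_sub_left _ (t • _), real_inner_smul_left]
        rfl
    _ = 0 := by rw [h3]; exact sub_eq_zero.2 h4

/-- On a ball the free motion is the particle's motion plus a multiple of the displacement from the
center, whose integral vanishes by symmetry. This holds also after the focusing time. -/
lemma setIntegral_eq (d : ℕ ⊕ ℕ) (t : ℝ) :
    ∫ x in part i j y Y d, Y 0 x + t • v₀ (Y 0 x) ∂μ = m d • planar i j (free y d t) := by
  have := h.transport.finite
  have hsub : Integrable (fun x => x - chunkCenter i j y d) (μ.map (Y 0)) := by
    rw [integrable_map_measure (by fun_prop) (h.transport.measurable 0).aemeasurable]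
    exact (h.integrable ⟨le_rfl, h.transport.pos.le⟩).sub (integrable_const _)
  have h1 : ∫ x in part i j y Y d, Y 0 x + t • v₀ (Y 0 x) ∂μ =
      ∫ x in chunk i j y d, x + t • v₀ x ∂(μ.map (Y 0)) := by
    rw [setIntegral_map (measurableSet_chunk i j y d) ?_ (h.transport.measurable 0).aemeasurable]
    · rfl
    · have := h.data.continuous
      exact (by fun_prop : Continuous fun x => x + t • v₀ x).aestronglyMeasurable
  have h2 : ∫ x in chunk i j y d, x + t • v₀ x ∂(μ.map (Y 0)) =
      ∫ x in chunk i j y d, (planar i j (free y d t) +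
        (1 - t * (isoTime (level d))⁻¹) • (x - chunkCenter i j y d)) ∂(μ.map (Y 0)) := by
    refine setIntegral_congr_fun (measurableSet_chunk i j y d) fun x hx => ?_
    simp only [h.data.velocity d x hx, planar_free]
    module
  have : IsFiniteMeasure (μ.map (Y 0)) := inferInstance
  have h3 : IntegrableOn (fun x => (1 - t * (isoTime (level d))⁻¹) • (x - chunkCenter i j y d))
      (chunk i j y d) (μ.map (Y 0)) :=
    (hsub.smul (1 - t * (isoTime (level d))⁻¹)).integrableOn
  rw [h1, h2, integral_add (integrable_const _) h3, integral_smul,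
    h.data.centered d, smul_zero, add_zero, setIntegral_const, h.data.real_chunk]

lemma smul_meanPos (d : ℕ ⊕ ℕ) (t : ℝ) :
    m d • meanPos i j y μ Y d t = ∫ x in part i j y Y d, Y t x ∂μ := by
  have := h.transport.finite
  rw [← h.real_part d, meanPos, measure_smul_setAverage _ (measure_ne_top _ _)]

lemma meanPos_mem {d : ℕ ⊕ ℕ} {t : ℝ} (ht : t ∈ Icc 0 T) {s : Set (Space n)} (hs : Convex ℝ s)
    (hsc : IsClosed s) (hY : ∀ᵐ x ∂μ, x ∈ part i j y Y d → Y t x ∈ s) :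
    meanPos i j y μ Y d t ∈ s := by
  have := h.transport.finite
  exact hs.set_average_mem hsc (h.measure_part_ne_zero d) (measure_ne_top _ _)
    ((ae_restrict_iff' (h.measurableSet_part d)).2 hY) (h.integrable ht).integrableOn

lemma norm_meanPos_sub_center_le (d : ℕ ⊕ ℕ) {t : ℝ} (ht : t ∈ Icc 0 T) :
    ‖meanPos i j y μ Y d t - chunkCenter i j y d‖ ≤ t + radius (level d) := by
  rw [← mem_closedBall_iff_norm]
  refine h.meanPos_mem ht (convex_closedBall _ _) Metric.isClosed_closedBall ?_
  filter_upwards [h.transport.good] with x hG hx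
  rw [mem_closedBall_iff_norm]
  exact h.norm_sub_le hG hx ht

lemma norm_meanPos_sub_le (d : ℕ ⊕ ℕ) {s t : ℝ} (hs : s ∈ Icc 0 T) (ht : t ∈ Icc 0 T) :
    ‖meanPos i j y μ Y d t - meanPos i j y μ Y d s‖ ≤ |t - s| := by
  have := h.transport.finite
  have h1 : meanPos i j y μ Y d t - meanPos i j y μ Y d s =
      ⨍ x in part i j y Y d, (Y t x - Y s x) ∂μ := by
    simp only [meanPos, setAverage_eq]
    rw [integral_sub (h.integrable ht).integrableOn (h.integrable hs).integrableOn, smul_sub]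
  rw [h1, ← mem_closedBall_zero_iff]
  refine (convex_closedBall _ _).set_average_mem Metric.isClosed_closedBall
    (h.measure_part_ne_zero d) (measure_ne_top _ _)
    ((ae_restrict_iff' (h.measurableSet_part d)).2 ?_)
    ((h.integrable ht).sub (h.integrable hs)).integrableOn
  filter_upwards [h.transport.good] with x hG _
  rw [mem_closedBall_zero_iff]
  exact h.transport.lipschitz x hG s hs t ht

/-! #### Separation of the chunks at small times -/

/-- The centers differ by ten times the maximum, and each point has strayed by slightly more than
the maximum at most. With the maximum rather than the minimum, a particle still isolated is also
separated from those already active. -/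
lemma max_isoTime_le_abs {c d : ℕ ⊕ ℕ} (hcd : c ≠ d) {t : ℝ}
    (ht : t ≤ max (isoTime (level c)) (isoTime (level d))) {p q : Space n}
    (hp : ‖p - chunkCenter i j y c‖ ≤ t + radius (level c))
    (hq : ‖q - chunkCenter i j y d‖ ≤ t + radius (level d)) :
    7 * max (isoTime (level c)) (isoTime (level d)) ≤ |(p - q) i| := by
  have h1 := isoTime_le_abs_free h.target_bounds hcd
  have h2 := radius_le (level c)
  have h3 := radius_le (level d)
  have h4 : |(p - chunkCenter i j y c) i| ≤ _ := (PiLp.norm_apply_le _ i).trans hp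
  have h5 : |(q - chunkCenter i j y d) i| ≤ _ := (PiLp.norm_apply_le _ i).trans hq
  simp only [PiLp.sub_apply, chunkCenter, planar_apply_fst h.ne] at h4 h5 ⊢
  have h6 := le_max_left (isoTime (level c)) (isoTime (level d))
  have h7 := le_max_right (isoTime (level c)) (isoTime (level d))
  have h8 : 10 * max (isoTime (level c)) (isoTime (level d)) ≤
      |(free y c 0).1 - (free y d 0).1| := by
    rcases max_choice (isoTime (level c)) (isoTime (level d)) with e | e <;> rw [e]
    exacts [h1.1, h1.2]
  set M := max (isoTime (level c)) (isoTime (level d))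
  have h9 := abs_le.1 h4
  have h10 := abs_le.1 h5
  have h11 := isoTime_pos (level c)
  rcases le_abs.1 h8 with h8 | h8
  · exact le_abs.2 (Or.inl (by linarith))
  · exact le_abs.2 (Or.inr (by linarith))

lemma isoTime_le_abs {c d : ℕ ⊕ ℕ} (hcd : c ≠ d) {t : ℝ} (ht : t ∈ Icc 0 T)
    (htc : t ≤ isoTime (level c)) :
    isoTime (level c) ≤ |meanPos i j y μ Y d t i - meanPos i j y μ Y c t i| := by
  have := h.max_isoTime_le_abs hcd (htc.trans (le_max_left _ _)) (h.norm_meanPos_sub_center_le c ht)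
    (h.norm_meanPos_sub_center_le d ht)
  rw [abs_sub_comm]
  exact ((le_max_left _ (isoTime (level d))).trans
    (by linarith [isoTime_pos (level c), le_max_left (isoTime (level c)) (isoTime (level d))])).trans
    this

lemma mem_closedBall_iff {c d : ℕ ⊕ ℕ} {t : ℝ} (ht : t ∈ Icc 0 T) (htc : t ≤ isoTime (level c))
    {x : Space n} (hG : x ∈ G) (hx : x ∈ part i j y Y d) :
    Y t x ∈ Metric.closedBall (chunkCenter i j y c) (3 * isoTime (level c)) ↔ d = c := by
  have h0 := isoTime_pos (level c)
  constructor
  · intro hY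
    by_contra hcd
    rw [mem_closedBall_iff_norm] at hY
    have h1 := h.max_isoTime_le_abs (Ne.symm hcd) (htc.trans (le_max_left _ _))
      (p := chunkCenter i j y c)
      (by rw [sub_self, norm_zero]; linarith [ht.1, radius_pos (level c)])
      (h.norm_sub_le hG hx ht)
    have h2 : |(chunkCenter i j y c - Y t x) i| ≤ ‖chunkCenter i j y c - Y t x‖ :=
      PiLp.norm_apply_le (chunkCenter i j y c - Y t x) i
    rw [norm_sub_rev] at h2
    linarith [le_max_left (isoTime (level c)) (isoTime (level d))]
  · rintro rfl
    rw [mem_closedBall_iff_norm]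
    linarith [h.norm_sub_le hG hx ht, radius_le (level d)]

/-! #### Focusing -/

/-- At this time the free motion sends the whole ball to one point `p`. Pairing the projection
identity with `Y - p`, cut off to a region which only this ball occupies, gives zero for the
integral of the squared distance to `p`. -/
lemma ae_eq_of_isoTime (d : ℕ ⊕ ℕ) (hd : isoTime (level d) ≤ T) :
    ∀ᵐ x ∂μ, x ∈ part i j y Y d →
      Y (isoTime (level d)) x = planar i j (free y d (isoTime (level d))) := by
  have := h.transport.finite
  set σ := isoTime (level d)
  have hσ : 0 < σ := isoTime_pos _
  have hσT : σ ∈ Icc 0 T := ⟨hσ.le, hd⟩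
  set p := planar i j (free y d σ) with hp
  let A := Metric.closedBall (chunkCenter i j y d) (3 * σ)
  let φ : Space n → Space n := A.indicator fun x => x - p
  have hA : MeasurableSet A := Metric.isClosed_closedBall.measurableSet
  have hφ : Measurable φ := (measurable_id.sub_const p).indicator hA
  have hC : ∀ x, ‖φ x‖ ≤ 3 * σ + ‖chunkCenter i j y d - p‖ := by
    intro x
    by_cases hx : x ∈ A
    · rw [show φ x = x - p from indicator_of_mem hx _]
      refine (norm_sub_le_norm_sub_add_norm_sub x (chunkCenter i j y d) p).trans ?_
      gcongr
      exact mem_closedBall_iff_norm.1 hx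
    · rw [show φ x = 0 from indicator_of_notMem hx _, norm_zero]
      positivity
  have hmem : ∀ᵐ x ∂μ, ∀ c, x ∈ part i j y Y c → (Y σ x ∈ A ↔ c = d) := by
    filter_upwards [h.transport.good] with x hG c hx
    exact h.mem_closedBall_iff hσT le_rfl hG hx
  have hint := h.integral_inner_defect hσT hφ hC
  have heq : (fun x => ⟪Y σ x - (Y 0 x + σ • v₀ (Y 0 x)), φ (Y σ x)⟫) =ᵐ[μ]
      fun x => ‖φ (Y σ x)‖ ^ 2 := by
    filter_upwards [hmem, h.ae_mem_part] with x hx ⟨c, hc⟩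
    by_cases hcd : c = d
    · subst hcd
      have h1 : φ (Y σ x) = Y σ x - p := indicator_of_mem ((hx c hc).2 rfl) _
      have h2 : Y 0 x + σ • v₀ (Y 0 x) = p := by
        rw [h.data.velocity c (Y 0 x) hc, hp, planar_free, smul_sub, smul_smul,
          mul_inv_cancel₀ hσ.ne', one_smul]
        abel
      rw [h2, h1, real_inner_self_eq_norm_sq]
    · have h1 : φ (Y σ x) = 0 := indicator_of_notMem (fun hA => hcd ((hx c hc).1 hA)) _
      rw [h1, inner_zero_right, norm_zero]
      norm_num
  rw [integral_congr_ae heq, integral_eq_zero_iff_of_nonneg (fun x => by positivity)] at hint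
  · filter_upwards [hint, hmem] with x h0 hx hxd
    have h1 : φ (Y σ x) = Y σ x - p := indicator_of_mem ((hx d hxd).2 rfl) _
    have h2 : ‖φ (Y σ x)‖ ^ 2 = 0 := h0
    rw [h1] at h2
    exact sub_eq_zero.1 (norm_eq_zero.1 (pow_eq_zero_iff two_ne_zero |>.1 h2))
  · refine Integrable.of_bound
      ((hφ.comp (h.transport.measurable σ)).norm.pow_const 2).aestronglyMeasurable
      ((3 * σ + ‖chunkCenter i j y d - p‖) ^ 2) (ae_of_all _ fun x => ?_)
    rw [Real.norm_of_nonneg (by positivity)]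
    gcongr
    exact hC _

/-- After it has focused to a point, a chunk follows the trajectory of one of its labels. -/
lemma exists_label (d : ℕ ⊕ ℕ) (hd : isoTime (level d) ≤ T) :
    ∃ x₀ ∈ G, ∀ t, isoTime (level d) ≤ t → t ≤ T → meanPos i j y μ Y d t = Y t x₀ ∧
      ∀ᵐ x ∂μ, x ∈ part i j y Y d → Y t x = Y t x₀ := by
  have hσ : 0 < isoTime (level d) := isoTime_pos _
  obtain ⟨x₀, ⟨hG₀, h₀⟩, hx₀⟩ : ∃ x₀, (x₀ ∈ G ∧ (x₀ ∈ part i j y Y d →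
      Y (isoTime (level d)) x₀ = planar i j (free y d (isoTime (level d))))) ∧
        x₀ ∈ part i j y Y d := by
    have h1 := h.transport.good.and (h.ae_eq_of_isoTime d hd)
    have h2 : ∃ᵐ x ∂μ, x ∈ part i j y Y d := by
      rw [frequently_ae_mem_iff]; exact h.measure_part_ne_zero d
    obtain ⟨x, hx, hx'⟩ := (h2.and_eventually h1).exists
    exact ⟨x, hx', hx⟩
  refine ⟨x₀, hG₀, fun t ht htT => ?_⟩
  have key : ∀ᵐ x ∂μ, x ∈ part i j y Y d → Y t x = Y t x₀ := by
    filter_upwards [h.transport.good, h.ae_eq_of_isoTime d hd] with x hG hx hxd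
    exact h.transport.sticky x hG x₀ hG₀ _ t hσ.le ht htT ((hx hxd).trans (h₀ hx₀).symm)
  exact ⟨h.meanPos_mem ⟨hσ.le.trans ht, htT⟩ (convex_singleton _) isClosed_singleton key, key⟩

/-! #### Centers of mass of clusters -/

-- The projection identity tested with `e` times the indicator of `A`: if the balls in `A` at time
-- `t` are exactly those in `U`, their total displacement from the mean free motion vanishes.
open Classical in
lemma tsum_inner_eq_zero {t : ℝ} (ht : t ∈ Icc 0 T) {A : Set (Space n)} (hA : MeasurableSet A)
    {U : Set (ℕ ⊕ ℕ)} (hU : ∀ᵐ x ∂μ, ∀ d, x ∈ part i j y Y d → (Y t x ∈ A ↔ d ∈ U))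
    (e : Space n) :
    ∑' d, (if d ∈ U then m d * ⟪planar i j (free y d t) - meanPos i j y μ Y d t, e⟫ else 0) = 0 := by
  have := h.transport.finite
  let φ : Space n → Space n := A.indicator fun _ => e
  have hφ : Measurable φ := measurable_const.indicator hA
  have hC : ∀ x, ‖φ x‖ ≤ ‖e‖ := fun x => norm_indicator_le_norm_self (fun _ => e) x
  have hint := integrable_inner_of_bound (h.integrable_defect ht)
    (hφ.comp (h.transport.measurable t)).aestronglyMeasurable (fun x => hC _)
  have hsum := hasSum_integral_iUnion h.measurableSet_part h.pairwise_disjoint_part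
    hint.integrableOn
  rw [Measure.restrict_eq_self_of_ae_mem (by simpa using h.ae_mem_part)] at hsum
  have h0 := h.integral_inner_defect ht hφ hC
  have hterm : ∀ d, ∫ x in part i j y Y d,
      ⟪Y t x - (Y 0 x + t • v₀ (Y 0 x)), (φ ∘ Y t) x⟫ ∂μ =
        -(if d ∈ U then m d * ⟪planar i j (free y d t) - meanPos i j y μ Y d t, e⟫ else 0) := by
    intro d
    have h1 : ∫ x in part i j y Y d,
        ⟪Y t x - (Y 0 x + t • v₀ (Y 0 x)), (φ ∘ Y t) x⟫ ∂μ = ∫ x in part i j y Y d,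
          ⟪if d ∈ U then e else 0, Y t x - (Y 0 x + t • v₀ (Y 0 x))⟫ ∂μ := by
      refine setIntegral_congr_ae (h.measurableSet_part d) ?_
      filter_upwards [hU] with x hx hxd
      have h2 : (φ ∘ Y t) x = if d ∈ U then e else 0 := by
        simp only [φ, Function.comp_apply, indicator_apply, hx d hxd]
      rw [h2, real_inner_comm]
    have h2 : Integrable (fun x => Y 0 x + t • v₀ (Y 0 x)) μ :=
      (h.integrable ⟨le_rfl, h.transport.pos.le⟩).add (h.integrable_velocity.smul t)
    rw [h1, integral_inner (h.integrable_defect ht).integrableOn,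
      integral_sub (h.integrable ht).integrableOn h2.integrableOn,
      ← h.smul_meanPos, h.setIntegral_eq, ← smul_sub, real_inner_smul_right]
    split_ifs
    · rw [real_inner_comm, ← neg_sub (planar i j _), inner_neg_left, mul_neg]
    · rw [inner_zero_left, mul_zero, neg_zero]
  have h3 := hsum.tsum_eq.trans h0
  simp only [hterm, tsum_neg, neg_eq_zero] at h3
  exact h3

lemma meanPos_eq_of_le_isoTime {c : ℕ ⊕ ℕ} {t : ℝ} (ht : t ∈ Icc 0 T)
    (htc : t ≤ isoTime (level c)) : meanPos i j y μ Y c t = planar i j (free y c t) := by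
  have hU : ∀ᵐ x ∂μ, ∀ d, x ∈ part i j y Y d →
      (Y t x ∈ Metric.closedBall (chunkCenter i j y c) (3 * isoTime (level c)) ↔
        d ∈ ({c} : Set (ℕ ⊕ ℕ))) := by
    filter_upwards [h.transport.good] with x hG d hx
    exact h.mem_closedBall_iff ht htc hG hx
  have h1 := h.tsum_inner_eq_zero ht Metric.isClosed_closedBall.measurableSet hU
    -- The direction tested is the displacement itself, so its squared norm vanishes.
    (planar i j (free y c t) - meanPos i j y μ Y c t)
  simp only [mem_singleton_iff, tsum_ite_eq, mul_eq_zero] at h1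
  have h2 := h1.resolve_left (h.data.mass.pos c).ne'
  exact (sub_eq_zero.1 (inner_self_eq_zero.1 h2)).symm

-- After `c` has focused, its cluster is cut out by the single point it occupies: each other ball is
-- either focused, hence wholly there or not there, or still isolated, hence away from that point.
open Classical in
lemma tsum_cluster_eq_zero (c : ℕ ⊕ ℕ) {t : ℝ} (ht : t ∈ Icc 0 T) (e : Space n) :
    ∑' d, (if d ∈ {d | meanPos i j y μ Y d t = meanPos i j y μ Y c t} then
      m d * ⟪planar i j (free y d t) - meanPos i j y μ Y c t, e⟫ else 0) = 0 := by
  rcases le_or_gt t (isoTime (level c)) with htc | htc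
  · have h0 : m c * ⟪planar i j (free y c t) - meanPos i j y μ Y c t, e⟫ = 0 := by
      rw [h.meanPos_eq_of_le_isoTime ht htc, sub_self, inner_zero_left, mul_zero]
    rw [tsum_eq_single c fun d hd => if_neg fun hdc => ?_, h0, ite_self]
    have h1 := h.isoTime_le_abs hd.symm ht htc
    have h2 : meanPos i j y μ Y d t = meanPos i j y μ Y c t := hdc
    rw [h2, sub_self, abs_zero] at h1
    exact (isoTime_pos _).not_ge h1
  · have hU : ∀ᵐ x ∂μ, ∀ d, x ∈ part i j y Y d → (Y t x ∈ ({meanPos i j y μ Y c t} : Set (Space n)) ↔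
        d ∈ {d | meanPos i j y μ Y d t = meanPos i j y μ Y c t}) := by
      rw [ae_all_iff]
      intro d
      change ∀ᵐ x ∂μ, x ∈ part i j y Y d →
        (Y t x = meanPos i j y μ Y c t ↔ meanPos i j y μ Y d t = meanPos i j y μ Y c t)
      rcases lt_or_ge t (isoTime (level d)) with htd | htd
      · have hcd : c ≠ d := by rintro rfl; exact lt_asymm htc htd
        have hne : ∀ q, ‖q - chunkCenter i j y d‖ ≤ t + radius (level d) →
            q ≠ meanPos i j y μ Y c t := by
          rintro q hq rfl
          have h1 := h.max_isoTime_le_abs hcd (htd.le.trans (le_max_right _ _))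
            (h.norm_meanPos_sub_center_le c ht) hq
          rw [sub_self, PiLp.zero_apply, abs_zero] at h1
          linarith [isoTime_pos (level c), le_max_left (isoTime (level c)) (isoTime (level d))]
        filter_upwards [h.transport.good] with x hG hx
        exact iff_of_false (hne _ (h.norm_sub_le hG hx ht))
          (hne _ (h.norm_meanPos_sub_center_le d ht))
      · obtain ⟨x₀, -, hx₀⟩ := h.exists_label d (htd.trans ht.2)
        obtain ⟨h1, h2⟩ := hx₀ t htd ht.2
        filter_upwards [h2] with x hx hxd
        rw [hx hxd, h1]
    refine (tsum_congr fun d => ?_).trans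
      (h.tsum_inner_eq_zero ht (measurableSet_singleton _) hU e)
    split_ifs with hd
    · rw [show meanPos i j y μ Y d t = meanPos i j y μ Y c t from hd]
    · rfl

/-- All free motions lie in the coordinate plane, so do the means. Two coordinates then suffice to
decide whether particles coincide, which reduces dimension `n` to the plane. -/
lemma meanPos_apply_of_ne (c : ℕ ⊕ ℕ) {t : ℝ} (ht : t ∈ Icc 0 T) {l : Fin n} (hi : l ≠ i)
    (hj : l ≠ j) : meanPos i j y μ Y c t l = 0 := by
  classical
  have h1 := h.tsum_cluster_eq_zero c ht (EuclideanSpace.single l (1 : ℝ))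
  simp only [EuclideanSpace.inner_single_right, PiLp.sub_apply, planar_apply_of_ne hi hj] at h1
  by_contra hne
  have h2 : (fun d => if d ∈ {d | meanPos i j y μ Y d t = meanPos i j y μ Y c t} then
      m d * (1 * (starRingEnd ℝ) (0 - meanPos i j y μ Y c t l)) else 0) = fun d =>
      (if d ∈ {d | meanPos i j y μ Y d t = meanPos i j y μ Y c t} then m d else 0) *
        -(meanPos i j y μ Y c t l) := by
    funext d; split_ifs <;> simp
  rw [h2, tsum_mul_right, mul_eq_zero] at h1
  refine h1.elim (fun h3 => ?_) fun h3 => hne (neg_eq_zero.1 h3)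
  have h4 := (h.data.mass.summable_ite {d | meanPos i j y μ Y d t = meanPos i j y μ Y c t}).tsum_pos
    (fun d => ?_) c (by simpa using h.data.mass.pos c)
  · exact h4.ne' h3
  · split_ifs
    exacts [(h.data.mass.pos d).le, le_rfl]

lemma ext_meanPos {c d : ℕ ⊕ ℕ} {t : ℝ} (ht : t ∈ Icc 0 T)
    (hi : meanPos i j y μ Y c t i = meanPos i j y μ Y d t i)
    (hj : meanPos i j y μ Y c t j = meanPos i j y μ Y d t j) :
    meanPos i j y μ Y c t = meanPos i j y μ Y d t := by
  ext l
  by_cases hli : l = i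
  · rw [hli, hi]
  by_cases hlj : l = j
  · rw [hlj, hj]
  rw [h.meanPos_apply_of_ne c ht hli hlj, h.meanPos_apply_of_ne d ht hli hlj]

lemma meanPos_eq_of_le {c d : ℕ ⊕ ℕ} {s t : ℝ} (hs : 0 ≤ s) (hst : s ≤ t) (htT : t ≤ T)
    (he : meanPos i j y μ Y c s = meanPos i j y μ Y d s) :
    meanPos i j y μ Y c t = meanPos i j y μ Y d t := by
  rcases eq_or_ne c d with rfl | hcd
  · rfl
  have key : ∀ a b, a ≠ b → meanPos i j y μ Y a s = meanPos i j y μ Y b s →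
      isoTime (level a) ≤ s := by
    intro a b hab hab'
    by_contra! hlt
    have := h.isoTime_le_abs hab ⟨hs, hst.trans htT⟩ hlt.le
    rw [hab', sub_self, abs_zero] at this
    exact (isoTime_pos _).not_ge this
  have hc := key c d hcd he
  have hd := key d c hcd.symm he.symm
  obtain ⟨x₁, hG₁, h₁⟩ := h.exists_label c (hc.trans (hst.trans htT))
  obtain ⟨x₂, hG₂, h₂⟩ := h.exists_label d (hd.trans (hst.trans htT))
  rw [(h₁ s hc (hst.trans htT)).1, (h₂ s hd (hst.trans htT)).1] at he
  rw [(h₁ t (hc.trans hst) htT).1, (h₂ t (hd.trans hst) htT).1]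
  exact h.transport.sticky x₁ hG₁ x₂ hG₂ s t hs hst htT he

theorem exists_isStickySystem : ∃ Z, IsStickySystem T m y Z := by
  -- `IsStickySystem` asks for Lipschitz paths at all real times, so the paths are frozen outside
  -- `[0, T]`.
  let clamp : ℝ → ℝ := fun t => max (min t T) 0
  have hclamp : ∀ t, clamp t ∈ Icc 0 T := fun t =>
    ⟨le_max_right _ _, max_le (min_le_right _ _) h.transport.pos.le⟩
  have hclamp' : ∀ t, 0 ≤ t → t ≤ T → clamp t = t := fun t h0 hT => by
    simp only [clamp, min_eq_left hT, max_eq_left h0]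
  have hlip : ∀ s t, |clamp s - clamp t| ≤ |s - t| := fun s t =>
    (abs_max_sub_max_le_abs _ _ _).trans ((abs_min_sub_min_le_max _ _ _ _).trans (by simp))
  let Z : ℕ ⊕ ℕ → ℝ → ℝ × ℝ := fun d t =>
    (meanPos i j y μ Y d (clamp t) i, meanPos i j y μ Y d (clamp t) j)
  have hZ : ∀ d t, 0 ≤ t → t ≤ T → Z d t = (meanPos i j y μ Y d t i, meanPos i j y μ Y d t j) :=
    fun d t h0 hT => by simp only [Z, hclamp' t h0 hT]
  have hZeq : ∀ c d t, 0 ≤ t → t ≤ T →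
      (Z c t = Z d t ↔ meanPos i j y μ Y c t = meanPos i j y μ Y d t) := by
    intro c d t h0 hT
    rw [hZ c t h0 hT, hZ d t h0 hT, Prod.mk.injEq]
    exact ⟨fun he => h.ext_meanPos ⟨h0, hT⟩ he.1 he.2, fun he => by rw [he]; exact ⟨rfl, rfl⟩⟩
  refine ⟨Z, h.data.mass, h.data.target, fun c s t => ?_, fun c d s t hs hst hT he => ?_,
    fun c d t h0 hT htc hdc => ?_, fun c t h0 hT => ?_, fun c t h0 hT => ?_⟩
  · have h1 := (h.norm_meanPos_sub_le c (hclamp t) (hclamp s)).trans (hlip s t)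
    have h2 := fun l => (PiLp.norm_apply_le (meanPos i j y μ Y c (clamp s) -
      meanPos i j y μ Y c (clamp t)) l).trans h1
    rw [Prod.dist_eq, max_le_iff, dist_eq_norm, dist_eq_norm]
    exact ⟨h2 i, h2 j⟩
  · rw [hZeq c d s hs (hst.trans hT)] at he
    rw [hZeq c d t (hs.trans hst) hT]
    exact h.meanPos_eq_of_le hs hst hT he
  · rw [hZ c t h0 hT, hZ d t h0 hT, Prod.dist_eq]
    exact (h.isoTime_le_abs hdc.symm ⟨h0, hT⟩ htc).trans (le_max_left _ _)
  · refine (tsum_congr fun d => if_congr (hZeq d c t h0 hT) ?_ rfl).trans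
      (h.tsum_cluster_eq_zero c ⟨h0, hT⟩ (EuclideanSpace.single i (1 : ℝ)))
    rw [hZ c t h0 hT]
    simp [EuclideanSpace.inner_single_right, planar_apply_fst h.ne]
  · refine (tsum_congr fun d => if_congr (hZeq d c t h0 hT) ?_ rfl).trans
      (h.tsum_cluster_eq_zero c ⟨h0, hT⟩ (EuclideanSpace.single j (1 : ℝ)))
    rw [hZ c t h0 hT]
    simp [EuclideanSpace.inner_single_right, planar_apply_snd h.ne]

end IsChunkTransport

end StickyGas

end

theorem theorem1 (n : ℕ) (hn : 2 ≤ n) :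
    ∃ (r : EuclideanSpace ℝ (Fin n) → ℝ)
      (v₀ : EuclideanSpace ℝ (Fin n) → EuclideanSpace ℝ (Fin n)),
      ContDiff ℝ ∞ r ∧ HasCompactSupport r ∧ (∀ x, 0 ≤ r x) ∧ ∫ x, r x = 1 ∧
      Continuous v₀ ∧ HasCompactSupport v₀ ∧
      ∀ T : ℝ, 0 < T →
        ∀ D : Set (EuclideanSpace ℝ (Fin n)), IsOpen D → volume D = 1 →
          ¬ ∃ X : ℝ → EuclideanSpace ℝ (Fin n) → EuclideanSpace ℝ (Fin n),
            StickyGas.IsStickyWeakSolution (volume.withDensity fun x => ENNReal.ofReal (r x))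
              v₀ T D X := by
  -- Two distinct axes exist because `2 ≤ n`; the data built on them depend on neither `T` nor `D`.
  have hij : (⟨0, by omega⟩ : Fin n) ≠ ⟨1, by omega⟩ := by simp
  obtain ⟨r, v₀, hr, hrc, hr0, hr1, hv, hvc, m, y, hdata⟩ := StickyGas.exists_isChunkData hij
  refine ⟨r, v₀, hr, hrc, hr0, hr1, hv, hvc, fun T hT D hD hD1 ⟨X, hX⟩ => ?_⟩
  have : IsFiniteMeasure (volume.withDensity fun x => ENNReal.ofReal (r x)) :=
    isFiniteMeasure_withDensity_ofReal (hr.continuous.integrable_of_hasCompactSupport hrc).2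
  obtain ⟨Y, G, hY, hmap⟩ := hX.exists_transport hT hD.measurableSet (by simp [hD1]) hv
    hdata.norm_le
  rw [← hmap] at hdata
  obtain ⟨Z, hZ⟩ := StickyGas.IsChunkTransport.exists_isStickySystem ⟨hij, hdata, hY⟩
  exact hZ.false_of_pos hT
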